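/- For a permutation $\pi=(\pi_1,\dots,\pi_n)\in S_n$, $n\ge 1$, and $r\in\{1,\dots,n+1\}$, consider the following configuration of $n+1$ labelled chips on $\mathbb Z$: raise by $1$ all entries of $\pi$ that are $\ge r$, put the resulting labels, in order, at the sites $-\lfloor (n-1)/2\rfloor,\dots,\lfloor n/2\rfloor$, and put an additional chip $r$ at the site $0$. A toppling move chooses two chips $\alpha<\beta$ at a common site $i$ and moves $\alpha$ to $i-1$ and $\beta$ to $i+1$; moves are made until no site holds two chips. The permutation $\pi$ is $r$-toppleable if final configurations are reached and all of them, whatever the choices made, have the chips $1,2,\dots,n+1$ in this order from left to right; it is toppleable if it is $r$-toppleable for all $r\in\{1,\dots,n+1\}$. Let $t(n)$ be the number of toppleable permutations in $S_n$. An acyclic orientation with unique sink $s$ of a graph is an orientation of its edges without directed cycles for which $s$ is the one and only vertex without outgoing arrows. (1) For all $n\ge 1$ and every vertex $s$ of the complete bipartite graph $K_{\lceil n/2\rceil,\lfloor n/2\rfloor+1}$, the number $t(n)$ equals the number of acyclic orientations of $K_{\lceil n/2\rceil,\lfloor n/2\rfloor+1}$ with unique sink $s$. (2) Let $m\ge 0$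 and $n\ge 1$. For a permutation $\sigma\in S_{m+n}$ whose excedance set $\{i:\sigma(i)>i\}$ is $\{1,\dots,m\}$, write each cycle of $\sigma$ (fixed points included) with its least element first, place the cycles in a row with their least elements decreasing from left to right, and remove the parentheses. Orient each edge of $K_{m,n}$, with parts $\{1,\dots,m\}$ and $\{m+1,\dots,m+n\}$, from the endpoint further left in the resulting word to the one further right. Finally add a new vertex $s$ to the part $\{1,\dots,m\}$, joined to $m+1,\dots,m+n$ by edges that point to $s$. This defines a bijection from the set of permutations in $S_{m+n}$ with excedance set $\{1,\dots,m\}$ onto the set of acyclic orientations of $K_{m+1,n}$ with unique sink $s$. -/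

import Mathlib

open Equiv

/-! ## Toppling of labelled chips on the integers

The chips are labelled by `Fin (n + 1)`, the chip `k : Fin (n + 1)` being the one with label
`k + 1`. A configuration sends each chip to the site at which it lies. -/

/-- One toppling move: two chips `α < β` at a common site move apart, `α` one step to the left
and `β` one step to the right. -/
def ToppleStep {k : ℕ} (c d : Fin k → ℤ) : Prop :=
  ∃ α β : Fin k, α < β ∧ c α = c β ∧
    d = Function.update (Function.update c α (c α - 1)) β (c β + 1)

/-- A configuration is final if no site holds two or more chips. -/
def IsFinal {k : ℕ} (c : Fin k → ℤ) : Prop := Function.Injective c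

/-- The initial configuration of `π ∈ S_n` and `r ∈ [n + 1]`. The entries of `π` lie, from left to
right, at the sites `-⌊(n - 1) / 2⌋, …, ⌊n / 2⌋`; the labels that are at least `r` are raised by one
(the shift `Fin.succAbove r`), and the chip `r` is put at the origin. -/
def initialConf {n : ℕ} (π : Perm (Fin n)) (r : Fin (n + 1)) : Fin (n + 1) → ℤ :=
  Fin.insertNth (α := fun _ => ℤ) r 0
    (fun j => ((π.symm j : ℕ) : ℤ) - (((n - 1) / 2 : ℕ) : ℤ))

/-- The permutations `τ ∈ S_{n + 1}` that arise by running the toppling moves, in some order, from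
the initial configuration of `π` and `r` to a final configuration and reading the chips of the
latter from left to right (`τ i` is the `i`-th chip from the left). -/
def toppleResults {n : ℕ} (π : Perm (Fin n)) (r : Fin (n + 1)) : Set (Perm (Fin (n + 1))) :=
  {τ | ∃ d : Fin (n + 1) → ℤ, Relation.ReflTransGen ToppleStep (initialConf π r) d ∧
    IsFinal d ∧ StrictMono (fun i => d (τ i))}

/-- `π` is `r`-toppleable: toppling ends, whatever the choices, with the chips sorted. -/
def IsRToppleable {n : ℕ} (π : Perm (Fin n)) (r : Fin (n + 1)) : Prop :=
  toppleResults π r = {1}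

/-- `π` is toppleable if it is `r`-toppleable for all `r ∈ [n + 1]`. -/
def IsToppleable {n : ℕ} (π : Perm (Fin n)) : Prop :=
  ∀ r : Fin (n + 1), IsRToppleable π r

/-- The number `t(n)` of toppleable permutations in `S_n`. -/
noncomputable def toppleCount (n : ℕ) : ℕ :=
  {π : Perm (Fin n) | IsToppleable π}.ncard

/-! ## Acyclic orientations with a fixed unique sink -/

/-- `D` is an orientation of the simple graph `G`: each edge gets exactly one of its two
directions, and there are no other arrows. -/
def IsOrientationOf {V : Type*} (G : SimpleGraph V) (D : Digraph V) : Prop :=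
  (∀ u v, D.Adj u v → G.Adj u v) ∧ ∀ u v, G.Adj u v → (D.Adj u v ↔ ¬ D.Adj v u)

/-- There is no directed cycle. -/
def IsAcyclicDigraph {V : Type*} (D : Digraph V) : Prop :=
  ∀ v, ¬ Relation.TransGen D.Adj v v

/-- A sink is a vertex with no outgoing arrow. -/
def IsSinkOf {V : Type*} (D : Digraph V) (v : V) : Prop := ∀ w, ¬ D.Adj v w

/-- The acyclic orientations of `G` whose one and only sink is `s`. -/
def acyclicOrientationsWithSink {V : Type*} (G : SimpleGraph V) (s : V) : Set (Digraph V) :=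
  {D | IsOrientationOf G D ∧ IsAcyclicDigraph D ∧ ∀ v, IsSinkOf D v ↔ v = s}

/-! ## Permutations with a prescribed excedance set, and the explicit map -/

/-- The permutations of `N` letters whose set of excedances is exactly the set of the first `m`
positions. -/
def excedanceClass (N m : ℕ) : Set (Perm (Fin N)) :=
  {σ | {i : Fin N | i < σ i} = {i : Fin N | (i : ℕ) < m}}

/-- The least element of the cycle of `σ` that contains `x` (fixed points are cycles too). -/
noncomputable def cycleMin {N : ℕ} (σ : Perm (Fin N)) (x : Fin N) : Fin N := by
  classical
  exact (Finset.univ.filter (fun y => σ.SameCycle x y)).min'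
    ⟨x, by simp [Equiv.Perm.SameCycle.refl]⟩

/-- The place, counted from `0`, of `x` in its cycle when this is written with its least
element first. -/
noncomputable def cycleIndex {N : ℕ} (σ : Perm (Fin N)) (x : Fin N) : ℕ :=
  sInf {k : ℕ | (σ ^ k) (cycleMin σ x) = x}

/-- Write each cycle of `σ` with its least element first, put the cycles next to each other with
their least elements decreasing from left to right, and remove the parentheses: `u` stands to the
left of `v` in the resulting word. -/
def PrecedesInCycleWord {N : ℕ} (σ : Perm (Fin N)) (u v : Fin N) : Prop :=
  cycleMin σ v < cycleMin σ u ∨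
    (cycleMin σ u = cycleMin σ v ∧ cycleIndex σ u < cycleIndex σ v)

/-- The orientation of `K_{m,n}` for which the word of `σ` is a topological sort: the left vertices
are the first `m` letters, the right vertices the last `n`, and each edge points from the letter
further left in the word to the one further right. -/
def orientationOfPerm {m n : ℕ} (σ : Perm (Fin (m + n))) : Digraph (Fin m ⊕ Fin n) where
  Adj u v := (completeBipartiteGraph (Fin m) (Fin n)).Adj u v ∧
    PrecedesInCycleWord σ (finSumFinEquiv u) (finSumFinEquiv v)

/-- The inclusion of the vertices of `K_{m,n}` into those of `K_{m+1,n}` that misses the last left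
vertex. -/
def includeVertex {m n : ℕ} : Fin m ⊕ Fin n → Fin (m + 1) ⊕ Fin n := Sum.map Fin.castSucc id

/-- Add a new last left vertex to `K_{m,n}`, with all edges between it and the right vertices
pointing to it. -/
def addSink {m n : ℕ} (D : Digraph (Fin m ⊕ Fin n)) : Digraph (Fin (m + 1) ⊕ Fin n) where
  Adj x y := (∃ u v, x = includeVertex u ∧ y = includeVertex v ∧ D.Adj u v) ∨
    (∃ j : Fin n, x = Sum.inr j ∧ y = Sum.inl (Fin.last m))

/-! Statement (2). Inside a cycle the letter after `x` is `σ x`, and a new cycle opens with a letter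
smaller than all earlier ones. So excedances are exactly the letters followed by a larger letter
(`FollowsInCycleWord.apply_eq_of_lt`, `FollowsInCycleWord.lt_of_apply_le`). Excedance set `{1, …,
m}` thus means: runs of left letters increase, runs of right letters decrease, and the word does not
end with a left letter. An acyclic orientation of `K_{m,n}` is an alternating sequence of left and
right blocks, and `sortKey` is its one topological sort with left blocks increasing and right blocks
decreasing. Hence the orientation determines the word (`precedes_iff_sortKey_lt`), and the word
determines `σ` (`precedesInCycleWord_injective`). Conversely the sort of an orientation comes from
the excedance class as soon as each left vertex has an outgoing arrow
(`mem_excedanceClass_of_precedes`). This is what uniqueness of the sink `s` demands, since the right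
vertices point to `s`.

Statement (1). Toppling runs a sorting network on a grid. The additional chip and the chips at
negative sites enter the rows, the others the columns; a move passes one comparator, which sends the
larger chip on along the row and the smaller one along the column. The comparators passed form a
staircase, and chips meet only at its corners, so the result does not depend on the choices. It is
sorted if and only if no chip enters later than the row or column by which it has to leave
(`wireChip_eq_wireRank_iff`). Over all `r` this becomes a bound on displacements
(`isToppleable_iff`), which a rotation turns into the excedance condition of (2) (`toppleCount_eq`).
Finally, reversing a cut moves the sink along an edge, so in a connected graph the count is the same
for every sink (`ncard_acyclicOrientationsWithSink_of_connected`). -/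

/-! ### Least elements of cycles and places in cycles. -/

theorem sameCycle_cycleMin {N : ℕ} (σ : Perm (Fin N)) (x : Fin N) :
    σ.SameCycle x (cycleMin σ x) := by
  classical
  have h := Finset.min'_mem (Finset.univ.filter (fun y => σ.SameCycle x y))
    ⟨x, by simp [Equiv.Perm.SameCycle.refl]⟩
  have h2 := (Finset.mem_filter.1 h).2
  unfold cycleMin
  convert h2

theorem cycleMin_le_of_sameCycle {N : ℕ} {σ : Perm (Fin N)} {x y : Fin N}
    (h : σ.SameCycle x y) : cycleMin σ x ≤ y := by
  classical
  unfold cycleMin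
  exact Finset.min'_le _ _ (by simpa using h)

theorem cycleMin_le {N : ℕ} (σ : Perm (Fin N)) (x : Fin N) : cycleMin σ x ≤ x :=
  cycleMin_le_of_sameCycle (Perm.SameCycle.refl _ _)

theorem cycleMin_eq_of_sameCycle {N : ℕ} {σ : Perm (Fin N)} {x y : Fin N}
    (h : σ.SameCycle x y) : cycleMin σ x = cycleMin σ y :=
  le_antisymm (cycleMin_le_of_sameCycle (h.trans (sameCycle_cycleMin σ y)))
    (cycleMin_le_of_sameCycle (h.symm.trans (sameCycle_cycleMin σ x)))

theorem cycleMin_cycleMin {N : ℕ} (σ : Perm (Fin N)) (x : Fin N) :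
    cycleMin σ (cycleMin σ x) = cycleMin σ x :=
  (cycleMin_eq_of_sameCycle (sameCycle_cycleMin σ x)).symm

theorem cycleMin_apply {N : ℕ} (σ : Perm (Fin N)) (x : Fin N) :
    cycleMin σ (σ x) = cycleMin σ x :=
  (cycleMin_eq_of_sameCycle (Perm.sameCycle_apply_right.2 (Perm.SameCycle.refl σ x))).symm

theorem pow_cycleIndex {N : ℕ} (σ : Perm (Fin N)) (x : Fin N) :
    (σ ^ cycleIndex σ x) (cycleMin σ x) = x := by
  have h : {k : ℕ | (σ ^ k) (cycleMin σ x) = x}.Nonempty := by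
    obtain ⟨k, -, hk⟩ := (sameCycle_cycleMin σ x).symm.exists_pow_eq'
    exact ⟨k, hk⟩
  exact Nat.sInf_mem h

theorem cycleIndex_le {N : ℕ} {σ : Perm (Fin N)} {x : Fin N} {k : ℕ}
    (h : (σ ^ k) (cycleMin σ x) = x) : cycleIndex σ x ≤ k := Nat.sInf_le h

theorem cycleIndex_cycleMin {N : ℕ} (σ : Perm (Fin N)) (x : Fin N) :
    cycleIndex σ (cycleMin σ x) = 0 :=
  Nat.le_zero.1 (cycleIndex_le (by simp [cycleMin_cycleMin]))

theorem eq_of_cycleIndex_eq {N : ℕ} {σ : Perm (Fin N)} {x y : Fin N}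
    (h : cycleMin σ x = cycleMin σ y) (h' : cycleIndex σ x = cycleIndex σ y) : x = y := by
  rw [← pow_cycleIndex σ x, ← pow_cycleIndex σ y, h, h']

theorem cycleIndex_apply {N : ℕ} {σ : Perm (Fin N)} {x : Fin N} (h : σ x ≠ cycleMin σ x) :
    cycleIndex σ (σ x) = cycleIndex σ x + 1 := by
  refine le_antisymm (cycleIndex_le ?_) ?_
  · rw [cycleMin_apply, pow_succ', Perm.mul_apply, pow_cycleIndex]
  · have hk := pow_cycleIndex σ (σ x)
    rw [cycleMin_apply] at hk
    rcases hc : cycleIndex σ (σ x) with _ | k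
    · rw [hc] at hk
      exact absurd hk.symm h
    · rw [hc, pow_succ', Perm.mul_apply] at hk
      exact Nat.succ_le_succ (cycleIndex_le (σ.injective hk))

/-- Returning to the least element after `d = cycleIndex σ x + 1` steps makes the cycle
`d`-periodic, so every place can be reduced modulo `d`. -/
theorem cycleIndex_le_of_apply_eq_cycleMin {N : ℕ} {σ : Perm (Fin N)} {x y : Fin N}
    (h : σ x = cycleMin σ x) (hxy : cycleMin σ y = cycleMin σ x) :
    cycleIndex σ y ≤ cycleIndex σ x := by
  set d := cycleIndex σ x + 1 with hd
  have hper : (σ ^ d) (cycleMin σ x) = cycleMin σ x := by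
    rw [hd, pow_succ', Perm.mul_apply, pow_cycleIndex, h]
  have hmul : ∀ k : ℕ, (σ ^ (d * k)) (cycleMin σ x) = cycleMin σ x := by
    intro k
    induction k with
    | zero => simp
    | succ k ih => rw [Nat.mul_succ, pow_add, Perm.mul_apply, hper, ih]
  have hy := pow_cycleIndex σ y
  rw [hxy] at hy
  have hlt : cycleIndex σ y % d < d := Nat.mod_lt _ (by omega)
  have : cycleIndex σ y ≤ cycleIndex σ y % d := by
    apply cycleIndex_le
    rw [hxy]
    conv_rhs => rw [← hy, ← Nat.mod_add_div (cycleIndex σ y) d, pow_add, Perm.mul_apply, hmul]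
  omega

/-! ### The linear order given by the cycle word. -/

namespace PrecedesInCycleWord

variable {N : ℕ} {σ τ : Perm (Fin N)} {x y z : Fin N}

theorem irrefl (σ : Perm (Fin N)) (x : Fin N) : ¬ PrecedesInCycleWord σ x x := by
  simp [PrecedesInCycleWord]

theorem trans (h : PrecedesInCycleWord σ x y) (h' : PrecedesInCycleWord σ y z) :
    PrecedesInCycleWord σ x z := by
  unfold PrecedesInCycleWord at *
  grind

theorem asymm (h : PrecedesInCycleWord σ x y) : ¬ PrecedesInCycleWord σ y x :=
  fun h' => irrefl σ x (h.trans h')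

theorem total (h : x ≠ y) : PrecedesInCycleWord σ x y ∨ PrecedesInCycleWord σ y x := by
  have := @eq_of_cycleIndex_eq N σ x y
  unfold PrecedesInCycleWord
  grind

theorem cycleMin_le (h : PrecedesInCycleWord σ x y) : cycleMin σ y ≤ cycleMin σ x := by
  rcases h with h | h
  · exact h.le
  · exact h.1.ge

end PrecedesInCycleWord

theorem precedes_apply {N : ℕ} {σ : Perm (Fin N)} {x : Fin N} (h : σ x ≠ cycleMin σ x) :
    PrecedesInCycleWord σ x (σ x) :=
  Or.inr ⟨(cycleMin_apply σ x).symm, by rw [cycleIndex_apply h]; omega⟩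

theorem not_between_apply {N : ℕ} {σ : Perm (Fin N)} {x z : Fin N} (h : σ x ≠ cycleMin σ x)
    (hxz : PrecedesInCycleWord σ x z) : ¬ PrecedesInCycleWord σ z (σ x) := by
  have h1 := cycleMin_apply σ x
  have h2 := cycleIndex_apply h
  unfold PrecedesInCycleWord at *
  grind

/-- `y` is the letter right after `x` in the word of `σ`. -/
def FollowsInCycleWord {N : ℕ} (σ : Perm (Fin N)) (x y : Fin N) : Prop :=
  PrecedesInCycleWord σ x y ∧ ∀ z, PrecedesInCycleWord σ x z → ¬ PrecedesInCycleWord σ z y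

theorem followsInCycleWord_apply {N : ℕ} {σ : Perm (Fin N)} {x : Fin N}
    (h : σ x ≠ cycleMin σ x) : FollowsInCycleWord σ x (σ x) :=
  ⟨precedes_apply h, fun _ hz => not_between_apply h hz⟩

theorem FollowsInCycleWord.eq {N : ℕ} {σ : Perm (Fin N)} {x y z : Fin N}
    (h : FollowsInCycleWord σ x y) (h' : FollowsInCycleWord σ x z) : y = z := by
  by_contra hne
  rcases PrecedesInCycleWord.total (σ := σ) hne with h1 | h1
  · exact h'.2 _ h.1 h1
  · exact h.2 _ h'.1 h1

/-- The last letter of a cycle is followed by the least element of another cycle. -/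
theorem FollowsInCycleWord.lt_cycleMin {N : ℕ} {σ : Perm (Fin N)} {x y : Fin N}
    (h : FollowsInCycleWord σ x y) (hx : σ x = cycleMin σ x) : y < cycleMin σ x := by
  have h1 : cycleMin σ y < cycleMin σ x := by
    rcases h.1 with h1 | ⟨h1, h2⟩
    · exact h1
    · exact absurd (cycleIndex_le_of_apply_eq_cycleMin hx h1.symm) (by omega)
  -- Otherwise `cycleMin σ y` would stand strictly between `x` and `y`.
  have h2 : y = cycleMin σ y := by
    by_contra hne
    rcases PrecedesInCycleWord.total (σ := σ) hne with h3 | h3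
    · rcases h3 with h3 | h3
      · rw [cycleMin_cycleMin] at h3
        exact h3.ne rfl
      · rw [cycleIndex_cycleMin] at h3
        omega
    · exact h.2 _ (Or.inl (by rwa [cycleMin_cycleMin])) h3
  rwa [← h2] at h1

/-- An ascent of the word cannot cross from one cycle to the next, because the next cycle opens with
a smaller letter. -/
theorem FollowsInCycleWord.apply_eq_of_lt {N : ℕ} {σ : Perm (Fin N)} {x y : Fin N}
    (h : FollowsInCycleWord σ x y) (hxy : x < y) : σ x = y := by
  by_cases hx : σ x = cycleMin σ x
  · exact absurd (hxy.trans (h.lt_cycleMin hx)) (not_lt.2 (cycleMin_le σ x))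
  · exact (followsInCycleWord_apply hx).eq h

theorem FollowsInCycleWord.lt_of_apply_le {N : ℕ} {σ : Perm (Fin N)} {x y : Fin N}
    (h : FollowsInCycleWord σ x y) (hx : σ x ≤ x) : y < x := by
  by_cases hx' : σ x = cycleMin σ x
  · exact (h.lt_cycleMin hx').trans_le (cycleMin_le σ x)
  · obtain rfl := (followsInCycleWord_apply hx').eq h
    exact lt_of_le_of_ne hx fun h' => PrecedesInCycleWord.irrefl σ x (by simpa [h'] using h.1)

theorem followsInCycleWord_apply_of_lt {N : ℕ} {σ : Perm (Fin N)} {x : Fin N} (h : x < σ x) :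
    FollowsInCycleWord σ x (σ x) :=
  followsInCycleWord_apply ((cycleMin_le σ x).trans_lt h).ne'

theorem transGen_followsInCycleWord {N : ℕ} {σ : Perm (Fin N)} {x y : Fin N}
    (h : PrecedesInCycleWord σ x y) : Relation.TransGen (FollowsInCycleWord σ) x y := by
  classical
  induction hk : (Finset.univ.filter fun z => PrecedesInCycleWord σ x z ∧
    PrecedesInCycleWord σ z y).card using Nat.strong_induction_on generalizing x y with
  | _ k ih =>
    by_cases hz : ∃ z, PrecedesInCycleWord σ x z ∧ PrecedesInCycleWord σ z y
    · obtain ⟨z, hxz, hzy⟩ := hz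
      refine (ih _ ?_ hxz rfl).trans (ih _ ?_ hzy rfl)
      · rw [← hk]
        refine Finset.card_lt_card (Finset.ssubset_iff_of_subset ?_ |>.2 ⟨z, ?_, ?_⟩)
        · intro w; simp only [Finset.mem_filter, Finset.mem_univ, true_and]
          exact fun hw => ⟨hw.1, hw.2.trans hzy⟩
        · simp [hxz, hzy]
        · simp [PrecedesInCycleWord.irrefl]
      · rw [← hk]
        refine Finset.card_lt_card (Finset.ssubset_iff_of_subset ?_ |>.2 ⟨z, ?_, ?_⟩)
        · intro w; simp only [Finset.mem_filter, Finset.mem_univ, true_and]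
          exact fun hw => ⟨hxz.trans hw.1, hw.2⟩
        · simp [hxz, hzy]
        · simp [PrecedesInCycleWord.irrefl]
    · exact .single ⟨h, fun z h1 h2 => hz ⟨z, h1, h2⟩⟩

theorem exists_followsInCycleWord {N : ℕ} {σ : Perm (Fin N)} {x y : Fin N}
    (h : PrecedesInCycleWord σ x y) : ∃ z, FollowsInCycleWord σ x z := by
  obtain ⟨z, hz, -⟩ := Relation.TransGen.head'_iff.1 (transGen_followsInCycleWord h)
  exact ⟨z, hz⟩

/-- The least element of a cycle is the least letter up to any letter of the cycle. -/
theorem isLeast_cycleMin {N : ℕ} (σ : Perm (Fin N)) (x : Fin N) :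
    IsLeast {y | ¬ PrecedesInCycleWord σ x y} (cycleMin σ x) := by
  refine ⟨?_, fun y hy => ?_⟩
  · simp [PrecedesInCycleWord, cycleMin_cycleMin, cycleIndex_cycleMin]
  · rcases eq_or_ne x y with rfl | hne
    · exact cycleMin_le σ x
    · exact ((PrecedesInCycleWord.total hne).resolve_left hy).cycleMin_le.trans (cycleMin_le σ y)

/-- By `isLeast_cycleMin` the cycle minima are running minima of the word, so the word shows where
it has to be cut into cycles; inside a cycle `σ x` is the next letter. -/
theorem precedesInCycleWord_injective {N : ℕ} :
    Function.Injective (PrecedesInCycleWord : Perm (Fin N) → Fin N → Fin N → Prop) := by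
  intro σ τ h
  have hmin : ∀ x, cycleMin σ x = cycleMin τ x := fun x => by
    have h1 := isLeast_cycleMin σ x
    rw [h] at h1
    exact h1.unique (isLeast_cycleMin τ x)
  have key : ∀ {σ τ : Perm (Fin N)}, PrecedesInCycleWord σ = PrecedesInCycleWord τ →
      (∀ x, cycleMin σ x = cycleMin τ x) → ∀ x, σ x ≠ cycleMin σ x → τ x = σ x := by
    intro σ τ h hmin x hx
    have h1 := followsInCycleWord_apply hx
    have h2 : FollowsInCycleWord τ x (σ x) := by
      unfold FollowsInCycleWord at *
      rwa [h] at h1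
    by_cases hx' : τ x = cycleMin τ x
    · have h3 := h2.lt_cycleMin hx'
      have h4 := cycleMin_le_of_sameCycle (σ := σ) (x := x) (y := σ x)
        (Perm.sameCycle_apply_right.2 (Perm.SameCycle.refl σ x))
      rw [hmin] at h4
      exact absurd h3 (not_lt.2 h4)
    · exact (followsInCycleWord_apply hx').eq h2
  ext1 x
  by_cases hx : σ x = cycleMin σ x
  · by_cases hx' : τ x = cycleMin τ x
    · rw [hx, hx', hmin]
    · exact key h.symm (fun x => (hmin x).symm) x hx'
  · exact (key h hmin x hx).symm

/-- The number of letters to the left of `x` in the word of `σ`. -/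
noncomputable def cycleWordRank {N : ℕ} (σ : Perm (Fin N)) (x : Fin N) : Fin N := by
  classical
  exact ⟨(Finset.univ.filter fun y => PrecedesInCycleWord σ y x).card, by
    conv_rhs => rw [← Fintype.card_fin N, ← Finset.card_univ]
    exact Finset.card_lt_card (Finset.ssubset_univ_iff.2 fun h => by
      have := Finset.mem_univ x
      rw [← h] at this
      exact PrecedesInCycleWord.irrefl σ x (Finset.mem_filter.1 this).2)⟩

theorem cycleWordRank_lt {N : ℕ} {σ : Perm (Fin N)} {x y : Fin N}
    (h : PrecedesInCycleWord σ x y) : cycleWordRank σ x < cycleWordRank σ y := by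
  classical
  unfold cycleWordRank
  rw [Fin.mk_lt_mk]
  refine Finset.card_lt_card (Finset.ssubset_iff_of_subset ?_ |>.2 ⟨x, ?_, ?_⟩)
  · intro w; simp only [Finset.mem_filter, Finset.mem_univ, true_and]
    exact fun hw => hw.trans h
  · simp [h]
  · simp [PrecedesInCycleWord.irrefl]

theorem cycleWordRank_lt_iff {N : ℕ} {σ : Perm (Fin N)} {x y : Fin N} :
    cycleWordRank σ x < cycleWordRank σ y ↔ PrecedesInCycleWord σ x y := by
  refine ⟨fun h => ?_, cycleWordRank_lt⟩
  rcases eq_or_ne x y with rfl | hne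
  · exact absurd h (lt_irrefl _)
  · exact (PrecedesInCycleWord.total hne).resolve_right fun h' =>
      absurd (cycleWordRank_lt h') (not_lt.2 h.le)

theorem cycleWordRank_bijective {N : ℕ} (σ : Perm (Fin N)) :
    Function.Bijective (cycleWordRank σ) := by
  refine Finite.injective_iff_bijective.1 fun x y h => ?_
  by_contra hne
  rcases PrecedesInCycleWord.total (σ := σ) hne with h' | h'
  · exact (cycleWordRank_lt h').ne h
  · exact (cycleWordRank_lt h').ne' h

/-- Every linear order of the letters is the order of the word of some permutation. -/
theorem exists_precedesInCycleWord_iff {N : ℕ} {β : Type*} [LinearOrder β] {f : Fin N → β}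
    (hf : Function.Injective f) :
    ∃ σ : Perm (Fin N), ∀ x y, PrecedesInCycleWord σ x y ↔ f x < f y := by
  -- Surjectivity by counting: sending a permutation to the ranks of its word is an injective
  -- self-map of the finite set `Perm (Fin N)`.
  have hsurj : Function.Surjective fun σ : Perm (Fin N) =>
      Equiv.ofBijective _ (cycleWordRank_bijective σ) := by
    refine Finite.injective_iff_surjective.1 fun σ τ h => precedesInCycleWord_injective ?_
    have h' : ∀ x, cycleWordRank σ x = cycleWordRank τ x := fun x => congrArg (· x) h
    ext x y
    rw [← cycleWordRank_lt_iff, ← cycleWordRank_lt_iff, h', h']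
  have hcard : (Finset.univ.image f).card = N := by
    rw [Finset.card_image_of_injective _ hf, Finset.card_fin]
  let e := ((Finset.univ.image f).orderIsoOfFin hcard).symm
  let g : Fin N → Fin N := fun x => e ⟨f x, Finset.mem_image_of_mem f (Finset.mem_univ x)⟩
  have hg : ∀ x y, g x < g y ↔ f x < f y := fun x y => by simp [g]
  have hginj : Function.Injective g := fun x y h => hf (by simpa [g] using h)
  obtain ⟨σ, hσ⟩ := hsurj (Equiv.ofBijective g (Finite.injective_iff_bijective.1 hginj))
  refine ⟨σ, fun x y => ?_⟩
  have h' : ∀ x, cycleWordRank σ x = g x := fun x => congrArg (· x) hσ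
  rw [← cycleWordRank_lt_iff, h', h', hg]

/-! ### Acyclicity and the added sink. -/

theorem isAcyclicDigraph_of_lt {V β : Type*} [Preorder β] {D : Digraph V} (f : V → β)
    (h : ∀ u v, D.Adj u v → f u < f v) : IsAcyclicDigraph D := by
  have key : ∀ u v, Relation.TransGen D.Adj u v → f u < f v := by
    intro u v huv
    induction huv with
    | single h' => exact h _ _ h'
    | tail _ h' ih => exact ih.trans (h _ _ h')
  exact fun v hv => lt_irrefl _ (key v v hv)

theorem IsAcyclicDigraph.comap {V W : Type*} {D : Digraph V} {D' : Digraph W}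
    (h : IsAcyclicDigraph D') (f : V → W) (hf : ∀ u v, D.Adj u v → D'.Adj (f u) (f v)) :
    IsAcyclicDigraph D :=
  fun v hv => h (f v) (hv.lift f hf)

section AddSink

variable {m n : ℕ} {D : Digraph (Fin m ⊕ Fin n)}

theorem includeVertex_injective : Function.Injective (includeVertex (m := m) (n := n)) :=
  Sum.map_injective.2 ⟨Fin.castSucc_injective m, Function.injective_id⟩

theorem includeVertex_ne_last (u : Fin m ⊕ Fin n) : includeVertex u ≠ Sum.inl (Fin.last m) := by
  rcases u with u | u <;> simp [includeVertex, (Fin.castSucc_lt_last u).ne]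

theorem eq_last_or_exists_includeVertex (x : Fin (m + 1) ⊕ Fin n) :
    x = Sum.inl (Fin.last m) ∨ ∃ u, x = includeVertex u := by
  rcases x with x | x
  · induction x using Fin.lastCases with
    | last => exact Or.inl rfl
    | cast i => exact Or.inr ⟨Sum.inl i, rfl⟩
  · exact Or.inr ⟨Sum.inr x, rfl⟩

theorem addSink_adj_includeVertex {u v : Fin m ⊕ Fin n} :
    (addSink D).Adj (includeVertex u) (includeVertex v) ↔ D.Adj u v := by
  constructor
  · rintro (⟨u', v', hu, hv, h⟩ | ⟨j, -, h⟩)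
    · rwa [includeVertex_injective hu, includeVertex_injective hv]
    · exact absurd h (includeVertex_ne_last v)
  · exact fun h => Or.inl ⟨u, v, rfl, rfl, h⟩

theorem not_addSink_adj_last {x : Fin (m + 1) ⊕ Fin n} :
    ¬ (addSink D).Adj (Sum.inl (Fin.last m)) x := by
  rintro (⟨u', v', hu, hv, h⟩ | ⟨j, h, -⟩)
  · exact absurd hu.symm (includeVertex_ne_last u')
  · simp at h

theorem addSink_adj_last {x : Fin (m + 1) ⊕ Fin n} :
    (addSink D).Adj x (Sum.inl (Fin.last m)) ↔ ∃ j, x = Sum.inr j := by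
  constructor
  · rintro (⟨u', v', hu, hv, h⟩ | ⟨j, h, -⟩)
    · exact absurd hv.symm (includeVertex_ne_last v')
    · exact ⟨j, h⟩
  · rintro ⟨j, rfl⟩
    exact Or.inr ⟨j, rfl, rfl⟩

theorem addSink_injective : Function.Injective (addSink (m := m) (n := n)) := by
  intro D D' h
  ext u v
  rw [← addSink_adj_includeVertex, h, addSink_adj_includeVertex]

theorem completeBipartiteGraph_adj_includeVertex {u v : Fin m ⊕ Fin n} :
    (completeBipartiteGraph (Fin (m + 1)) (Fin n)).Adj (includeVertex u) (includeVertex v) ↔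
      (completeBipartiteGraph (Fin m) (Fin n)).Adj u v := by
  rcases u with u | u <;> rcases v with v | v <;> simp [includeVertex]

theorem isOrientationOf_addSink
    (h : IsOrientationOf (completeBipartiteGraph (Fin m) (Fin n)) D) :
    IsOrientationOf (completeBipartiteGraph (Fin (m + 1)) (Fin n)) (addSink D) := by
  refine ⟨fun x y => ?_, fun x y => ?_⟩ <;>
    rcases eq_last_or_exists_includeVertex x with rfl | ⟨u, rfl⟩ <;>
    rcases eq_last_or_exists_includeVertex y with rfl | ⟨v, rfl⟩
  · exact fun h' => absurd h' not_addSink_adj_last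
  · exact fun h' => absurd h' not_addSink_adj_last
  · rw [addSink_adj_last]
    rintro ⟨j, hj⟩
    simp [hj]
  · rw [addSink_adj_includeVertex, completeBipartiteGraph_adj_includeVertex]
    exact h.1 u v
  · simp
  · rcases v with v | v
    · simp [includeVertex]
    · simp only [not_addSink_adj_last, addSink_adj_last, false_iff, not_not]
      exact fun _ => ⟨v, rfl⟩
  · rcases u with u | u
    · simp [includeVertex]
    · simp only [not_addSink_adj_last, addSink_adj_last, not_false_iff, iff_true]
      exact fun _ => ⟨u, rfl⟩
  · simp only [addSink_adj_includeVertex, completeBipartiteGraph_adj_includeVertex]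
    exact h.2 u v

theorem isAcyclicDigraph_addSink {k : ℕ} (f : Fin m ⊕ Fin n → Fin k)
    (h : ∀ u v, D.Adj u v → f u < f v) : IsAcyclicDigraph (addSink D) := by
  -- The new vertex gets the value `k`, above all values of `f`.
  let g : Fin (m + 1) ⊕ Fin n → ℕ := Sum.elim
    (Fin.lastCases (motive := fun _ => ℕ) k fun i => f (Sum.inl i)) fun j => f (Sum.inr j)
  have hg : ∀ u, g (includeVertex u) = f u := by
    rintro (u | u) <;> simp [g, includeVertex]
  refine isAcyclicDigraph_of_lt g fun x y hxy => ?_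
  rcases eq_last_or_exists_includeVertex x with rfl | ⟨u, rfl⟩
  · exact absurd hxy not_addSink_adj_last
  rcases eq_last_or_exists_includeVertex y with rfl | ⟨v, rfl⟩
  · rw [hg]
    simp [g]
  · rw [hg, hg]
    exact h u v (addSink_adj_includeVertex.1 hxy)

/-- Every orientation with sink the last left vertex comes from `addSink`. -/
theorem addSink_comap {D' : Digraph (Fin (m + 1) ⊕ Fin n)}
    (h : IsOrientationOf (completeBipartiteGraph (Fin (m + 1)) (Fin n)) D')
    (hs : IsSinkOf D' (Sum.inl (Fin.last m))) :
    addSink { Adj := fun u v => D'.Adj (includeVertex u) (includeVertex v) } = D' := by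
  ext x y
  rcases eq_last_or_exists_includeVertex x with rfl | ⟨u, rfl⟩
  · exact iff_of_false not_addSink_adj_last (hs y)
  rcases eq_last_or_exists_includeVertex y with rfl | ⟨v, rfl⟩
  · rw [addSink_adj_last]
    constructor
    · rintro ⟨j, hj⟩
      exact (h.2 _ _ (by simp [hj])).2 (hs _)
    · intro h'
      have := h.1 _ _ h'
      rcases u with u | u
      · simp [includeVertex] at this
      · exact ⟨u, rfl⟩
  · exact addSink_adj_includeVertex

end AddSink

/-! ### The canonical topological sort of an acyclic orientation of `K_{m,n}`. -/

section SortKey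

variable {m n : ℕ} {D : Digraph (Fin m ⊕ Fin n)}

open Classical in
/-- In an acyclic orientation of `K_{m,n}`, the right vertices that lie in an earlier block than
the given vertex. -/
noncomputable def earlierRight (D : Digraph (Fin m ⊕ Fin n)) : Fin m ⊕ Fin n → Finset (Fin n)
  | Sum.inl i => Finset.univ.filter fun v => D.Adj (Sum.inr v) (Sum.inl i)
  | Sum.inr j => Finset.univ.filter fun v =>
      ∃ u, D.Adj (Sum.inr v) (Sum.inl u) ∧ D.Adj (Sum.inl u) (Sum.inr j)

/-- Left vertices increase, right vertices decrease, and the former are below the latter. -/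
def sideKey : Fin m ⊕ Fin n → ℤ := Sum.elim (fun i => (i : ℤ) - m) (fun j => (n : ℤ) - j)

@[simp] theorem sideKey_inl (i : Fin m) : sideKey (Sum.inl i : Fin m ⊕ Fin n) = (i : ℤ) - m := rfl

@[simp] theorem sideKey_inr (j : Fin n) : sideKey (Sum.inr j : Fin m ⊕ Fin n) = (n : ℤ) - j := rfl

/-- The topological sort of an acyclic orientation of `K_{m,n}` in which left vertices that can be
exchanged increase, and right vertices that can be exchanged decrease. -/
noncomputable def sortKey (D : Digraph (Fin m ⊕ Fin n)) (x : Fin m ⊕ Fin n) : ℕ ×ₗ ℤ :=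
  toLex ((earlierRight D x).card, sideKey x)

theorem sortKey_injective : Function.Injective (sortKey D) := by
  intro x y h
  have h2 : sideKey x = sideKey y := congrArg (fun z => (ofLex z).2) h
  rcases x with x | x <;> rcases y with y | y <;> simp only [sideKey_inl, sideKey_inr] at h2 <;>
    first
    | (exfalso; omega)
    | (congr 1; ext; omega)

theorem sortKey_lt_of_subset {x y : Fin m ⊕ Fin n} (h : earlierRight D x ⊆ earlierRight D y)
    (h' : sideKey x < sideKey y) : sortKey D x < sortKey D y := by
  rw [sortKey, sortKey, Prod.Lex.toLex_lt_toLex]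
  rcases (Finset.card_le_card h).lt_or_eq with h1 | h1
  · exact Or.inl h1
  · exact Or.inr ⟨h1, h'⟩

theorem sortKey_lt_of_ssubset {x y : Fin m ⊕ Fin n} (h : earlierRight D x ⊂ earlierRight D y) :
    sortKey D x < sortKey D y := by
  rw [sortKey, sortKey, Prod.Lex.toLex_lt_toLex]
  exact Or.inl (Finset.card_lt_card h)

/-- Along an arrow from left to right `earlierRight` can stay the same; then the side key decides,
being negative on the left and positive on the right. Along an arrow from right to left the set
grows strictly, as it gains the tail. -/
theorem sortKey_lt_of_adj (hD : IsOrientationOf (completeBipartiteGraph (Fin m) (Fin n)) D)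
    (hA : IsAcyclicDigraph D) {x y : Fin m ⊕ Fin n} (h : D.Adj x y) : sortKey D x < sortKey D y := by
  have hxy := hD.1 _ _ h
  rcases x with i | j <;> rcases y with i' | j'
  · simp at hxy
  · refine sortKey_lt_of_subset (fun v hv => ?_) (by simp only [sideKey_inl, sideKey_inr]; omega)
    simp only [earlierRight, Finset.mem_filter, Finset.mem_univ, true_and] at hv ⊢
    exact ⟨i, hv, h⟩
  · refine sortKey_lt_of_ssubset (Finset.ssubset_iff_of_subset (fun v hv => ?_) |>.2 ⟨j, ?_, ?_⟩) <;>
      simp only [earlierRight, Finset.mem_filter, Finset.mem_univ, true_and] at *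
    · obtain ⟨u, h1, h2⟩ := hv
      by_contra h3
      have h4 := (hD.2 (Sum.inl i') (Sum.inr v) (by simp)).2 h3
      -- The directed 4-cycle `i' → v → u → j → i'`.
      exact hA _ ((((Relation.TransGen.single h4).tail h1).tail h2).tail h)
    · exact h
    · rintro ⟨u, h1, h2⟩
      exact hA _ ((Relation.TransGen.single h1).tail h2)
  · simp at hxy

theorem sortKey_lt_iff (hD : IsOrientationOf (completeBipartiteGraph (Fin m) (Fin n)) D)
    (hA : IsAcyclicDigraph D) {x y : Fin m ⊕ Fin n}
    (hxy : (completeBipartiteGraph (Fin m) (Fin n)).Adj x y) :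
    sortKey D x < sortKey D y ↔ D.Adj x y := by
  refine ⟨fun h => ?_, sortKey_lt_of_adj hD hA⟩
  by_contra h'
  exact lt_asymm h (sortKey_lt_of_adj hD hA ((hD.2 y x hxy.symm).2 h'))

/-- Left vertices in different blocks are separated by a right vertex, so they cannot be neighbours
in a topological sort. Comparing cardinalities is enough to find a separating vertex. -/
theorem exists_adj_of_earlierRight_card_lt (hD : IsOrientationOf (completeBipartiteGraph (Fin m) (Fin n)) D)
    {i i' : Fin m}
    (h : (earlierRight D (Sum.inl i)).card < (earlierRight D (Sum.inl i')).card) :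
    ∃ j, D.Adj (Sum.inl i) (Sum.inr j) ∧ D.Adj (Sum.inr j) (Sum.inl i') := by
  obtain ⟨j, hj, hj'⟩ := Finset.exists_mem_notMem_of_card_lt_card h
  simp only [earlierRight, Finset.mem_filter, Finset.mem_univ, true_and] at hj hj'
  exact ⟨j, (hD.2 _ _ (by simp)).2 hj', hj⟩

theorem exists_adj_of_earlierRight_inr_card_lt (hD : IsOrientationOf (completeBipartiteGraph (Fin m) (Fin n)) D)
    {j j' : Fin n}
    (h : (earlierRight D (Sum.inr j)).card < (earlierRight D (Sum.inr j')).card) :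
    ∃ i, D.Adj (Sum.inr j) (Sum.inl i) ∧ D.Adj (Sum.inl i) (Sum.inr j') := by
  obtain ⟨v, hv, hv'⟩ := Finset.exists_mem_notMem_of_card_lt_card h
  simp only [earlierRight, Finset.mem_filter, Finset.mem_univ, true_and, not_exists, not_and]
    at hv hv'
  obtain ⟨u, h1, h2⟩ := hv
  exact ⟨u, (hD.2 _ _ (by simp)).2 (hv' u h1), h2⟩

end SortKey

/-! ### Excedance classes and the bijection of statement (2). -/

section Excedance

variable {m n : ℕ} {σ : Perm (Fin (m + n))}

theorem lt_apply_iff_of_mem_excedanceClass {N : ℕ} {σ : Perm (Fin N)}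
    (h : σ ∈ excedanceClass N m) (i : Fin N) : i < σ i ↔ (i : ℕ) < m :=
  Set.ext_iff.1 h i

theorem isOrientationOf_orientationOfPerm (σ : Perm (Fin (m + n))) :
    IsOrientationOf (completeBipartiteGraph (Fin m) (Fin n)) (orientationOfPerm σ) := by
  refine ⟨fun u v h => h.1, fun u v h => ⟨fun h' h'' => h'.2.asymm h''.2, fun h' => ⟨h, ?_⟩⟩⟩
  refine (PrecedesInCycleWord.total fun h'' => ?_).resolve_right fun h'' => h' ⟨h.symm, h''⟩
  exact h.ne (finSumFinEquiv.injective h'')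

theorem cycleWordRank_lt_of_adj {u v : Fin m ⊕ Fin n} (h : (orientationOfPerm σ).Adj u v) :
    cycleWordRank σ (finSumFinEquiv u) < cycleWordRank σ (finSumFinEquiv v) :=
  cycleWordRank_lt h.2

/-- Neighbours on opposite sides are joined by an arrow. For neighbours on the same side,
transitivity of the word order gives an inclusion of the sets `earlierRight`, and the excedance
condition makes left neighbours ascend and right neighbours descend. -/
theorem sortKey_lt_of_follows (hσ : σ ∈ excedanceClass (m + n) m) {x y : Fin m ⊕ Fin n}
    (h : FollowsInCycleWord σ (finSumFinEquiv x) (finSumFinEquiv y)) :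
    sortKey (orientationOfPerm σ) x < sortKey (orientationOfPerm σ) y := by
  have hD := isOrientationOf_orientationOfPerm σ
  have hA : IsAcyclicDigraph (orientationOfPerm σ) :=
    isAcyclicDigraph_of_lt _ fun u v => cycleWordRank_lt_of_adj
  by_cases hxy : (completeBipartiteGraph (Fin m) (Fin n)).Adj x y
  · exact sortKey_lt_of_adj hD hA ⟨hxy, h.1⟩
  have hx := lt_apply_iff_of_mem_excedanceClass hσ (finSumFinEquiv x)
  rcases x with i | j <;> rcases y with i' | j'
  · refine sortKey_lt_of_subset (fun v hv => ?_) ?_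
    · simp only [earlierRight, Finset.mem_filter, Finset.mem_univ, true_and] at hv ⊢
      exact ⟨by simp, hv.2.trans h.1⟩
    · have h1 := followsInCycleWord_apply_of_lt (hx.2 (by simp))
      have h2 := hx.2 (by simp)
      rw [h1.eq h, Fin.lt_def] at h2
      simp at h2
      simpa using h2
  · simp at hxy
  · simp at hxy
  · refine sortKey_lt_of_subset (fun v hv => ?_) ?_
    · simp only [earlierRight, Finset.mem_filter, Finset.mem_univ, true_and] at hv ⊢
      obtain ⟨u, h1, h2⟩ := hv
      exact ⟨u, h1, by simp, h2.2.trans h.1⟩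
    · have h2 := h.lt_of_apply_le (not_lt.1 fun h' => by simpa using hx.1 h')
      rw [Fin.lt_def] at h2
      simp at h2
      simpa using h2

/-- The comparisons of neighbours chain up to all pairs; an implication between two linear orders is
an equivalence. -/
theorem precedes_iff_sortKey_lt (hσ : σ ∈ excedanceClass (m + n) m) (x y : Fin m ⊕ Fin n) :
    PrecedesInCycleWord σ (finSumFinEquiv x) (finSumFinEquiv y) ↔
      sortKey (orientationOfPerm σ) x < sortKey (orientationOfPerm σ) y := by
  have key : ∀ a b, Relation.TransGen (FollowsInCycleWord σ) a b →
      sortKey (orientationOfPerm σ) (finSumFinEquiv.symm a) <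
        sortKey (orientationOfPerm σ) (finSumFinEquiv.symm b) := by
    intro a b h
    induction h with
    | single h => exact sortKey_lt_of_follows hσ (by simpa using h)
    | tail _ h ih => exact ih.trans (sortKey_lt_of_follows hσ (by simpa using h))
  have key' : ∀ x y : Fin m ⊕ Fin n,
      PrecedesInCycleWord σ (finSumFinEquiv x) (finSumFinEquiv y) →
      sortKey (orientationOfPerm σ) x < sortKey (orientationOfPerm σ) y := fun x y h => by
    simpa using key _ _ (transGen_followsInCycleWord h)
  refine ⟨key' x y, fun h => ?_⟩
  refine (PrecedesInCycleWord.total fun h' => ?_).resolve_right fun h' => lt_asymm h (key' _ _ h')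
  rw [finSumFinEquiv.injective h'] at h
  exact lt_irrefl _ h

theorem orientationOfPerm_injOn :
    Set.InjOn (orientationOfPerm (m := m) (n := n)) (excedanceClass (m + n) m) := by
  intro σ hσ τ hτ h
  refine precedesInCycleWord_injective ?_
  ext x y
  obtain ⟨x, rfl⟩ := finSumFinEquiv.surjective x
  obtain ⟨y, rfl⟩ := finSumFinEquiv.surjective y
  rw [precedes_iff_sortKey_lt hσ, precedes_iff_sortKey_lt hτ, h]

/-- In the word of a permutation of the excedance class, a left letter is followed by some right
letter. -/
theorem exists_adj_of_mem_excedanceClass (hσ : σ ∈ excedanceClass (m + n) m) (i : Fin m) :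
    ∃ j, (orientationOfPerm σ).Adj (Sum.inl i) (Sum.inr j) := by
  suffices H : ∀ x : Fin (m + n), (x : ℕ) < m → ∃ j : Fin n, PrecedesInCycleWord σ x
      (finSumFinEquiv (Sum.inr j : Fin m ⊕ Fin n)) by
    obtain ⟨j, hj⟩ := H (finSumFinEquiv (Sum.inl i)) (by simp)
    exact ⟨j, by simp, hj⟩
  intro x
  -- As long as they stay among the left letters, the iterates of `σ` increase, so they reach a
  -- right letter without leaving the cycle word's order.
  induction x using WellFoundedGT.induction with
  | _ x ih =>
    intro hx
    have h1 := (lt_apply_iff_of_mem_excedanceClass hσ x).2 hx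
    have h2 := (followsInCycleWord_apply_of_lt h1).1
    by_cases h3 : (σ x : ℕ) < m
    · obtain ⟨j, hj⟩ := ih _ h1 h3
      exact ⟨j, h2.trans hj⟩
    · obtain ⟨y, hy⟩ := finSumFinEquiv.surjective (σ x)
      rw [← hy] at h2 h3
      rcases y with y | y
      · simp at h3
      · exact ⟨y, h2⟩

/-- A left letter is not the last one, thanks to `hout`; its successor is a right letter or the next
left letter of its block, larger in both cases. An excedance at a right letter would be followed by
a larger right letter of the same block, where letters decrease. -/
theorem mem_excedanceClass_of_precedes {D : Digraph (Fin m ⊕ Fin n)}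
    (hD : IsOrientationOf (completeBipartiteGraph (Fin m) (Fin n)) D) (hA : IsAcyclicDigraph D)
    (hout : ∀ i, ∃ j, D.Adj (Sum.inl i) (Sum.inr j))
    (h : ∀ x y, PrecedesInCycleWord σ (finSumFinEquiv x) (finSumFinEquiv y) ↔
      sortKey D x < sortKey D y) : σ ∈ excedanceClass (m + n) m := by
  refine Set.ext fun x => ?_
  obtain ⟨x, rfl⟩ := finSumFinEquiv.surjective x
  have hadj : ∀ x y, D.Adj x y → PrecedesInCycleWord σ (finSumFinEquiv x) (finSumFinEquiv y) :=
    fun x y hxy => (h x y).2 (sortKey_lt_of_adj hD hA hxy)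
  rcases x with i | j
  · simp only [Set.mem_ofPred_eq, finSumFinEquiv_apply_left, Fin.val_castAdd, Fin.is_lt, iff_true]
    rw [← finSumFinEquiv_apply_left]
    obtain ⟨j, hj⟩ := hout i
    obtain ⟨y, hy⟩ := exists_followsInCycleWord (hadj _ _ hj)
    obtain ⟨y, rfl⟩ := finSumFinEquiv.surjective y
    have hlt : finSumFinEquiv (Sum.inl i) < finSumFinEquiv y := by
      rcases y with i' | j'
      · have h1 := (h _ _).1 hy.1
        rw [sortKey, sortKey, Prod.Lex.toLex_lt_toLex] at h1
        rcases h1 with h1 | ⟨-, h1⟩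
        · obtain ⟨v, h2, h3⟩ := exists_adj_of_earlierRight_card_lt hD h1
          exact absurd (hadj _ _ h3) (hy.2 _ (hadj _ _ h2))
        · rw [Fin.lt_def]
          simp at h1 ⊢
          exact h1
      · rw [Fin.lt_def]
        simp
        omega
    rwa [hy.apply_eq_of_lt hlt]
  · simp only [Set.mem_ofPred_eq, finSumFinEquiv_apply_right, Fin.val_natAdd]
    rw [← finSumFinEquiv_apply_right]
    refine iff_of_false (fun hlt => ?_) (by omega)
    have hy := followsInCycleWord_apply_of_lt hlt
    obtain ⟨y, hy'⟩ := finSumFinEquiv.surjective (σ (finSumFinEquiv (Sum.inr j)))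
    rw [← hy'] at hy hlt
    rcases y with i' | j'
    · rw [Fin.lt_def] at hlt
      simp at hlt
      omega
    · have h1 := (h _ _).1 hy.1
      rw [sortKey, sortKey, Prod.Lex.toLex_lt_toLex] at h1
      rcases h1 with h1 | ⟨-, h1⟩
      · obtain ⟨v, h2, h3⟩ := exists_adj_of_earlierRight_inr_card_lt hD h1
        exact absurd (hadj _ _ h3) (hy.2 _ (hadj _ _ h2))
      · rw [Fin.lt_def] at hlt
        simp at hlt h1
        exact absurd hlt h1.le.not_gt

theorem addSink_orientationOfPerm_bijOn (m n : ℕ) :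
    Set.BijOn (fun σ : Perm (Fin (m + n)) => addSink (orientationOfPerm σ))
      (excedanceClass (m + n) m)
      (acyclicOrientationsWithSink (completeBipartiteGraph (Fin (m + 1)) (Fin n))
        (Sum.inl (Fin.last m))) := by
  refine ⟨fun σ hσ => ⟨isOrientationOf_addSink (isOrientationOf_orientationOfPerm σ),
    isAcyclicDigraph_addSink _ fun u v => cycleWordRank_lt_of_adj, fun x => ⟨fun hx => ?_, ?_⟩⟩,
    fun σ hσ τ hτ h => orientationOfPerm_injOn hσ hτ (addSink_injective h), fun D' hD' => ?_⟩
  · rcases eq_last_or_exists_includeVertex x with rfl | ⟨u | j, rfl⟩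
    · rfl
    · obtain ⟨j, hj⟩ := exists_adj_of_mem_excedanceClass hσ u
      exact absurd (addSink_adj_includeVertex.2 hj) (hx _)
    · exact absurd (addSink_adj_last.2 ⟨j, rfl⟩) (hx _)
  · rintro rfl
    exact fun _ => not_addSink_adj_last
  · obtain ⟨hD, hA, hs⟩ := hD'
    have hlast := (hs _).2 rfl
    set D : Digraph (Fin m ⊕ Fin n) :=
      { Adj := fun u v => D'.Adj (includeVertex u) (includeVertex v) } with hDdef
    have hsink : addSink D = D' := addSink_comap hD hlast
    have hDo : IsOrientationOf (completeBipartiteGraph (Fin m) (Fin n)) D :=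
      ⟨fun u v h => completeBipartiteGraph_adj_includeVertex.1 (hD.1 _ _ h),
        fun u v h => hD.2 _ _ (completeBipartiteGraph_adj_includeVertex.2 h)⟩
    have hDa : IsAcyclicDigraph D := hA.comap includeVertex fun _ _ h => h
    -- A left vertex other than the last is not a sink of `D'`, and its arrows can only lead to
    -- right vertices.
    have hout : ∀ i, ∃ j, D.Adj (Sum.inl i) (Sum.inr j) := by
      intro i
      have h1 := (not_congr (hs (includeVertex (Sum.inl i)))).2 (includeVertex_ne_last _)
      simp only [IsSinkOf, not_forall, not_not] at h1
      obtain ⟨w, hw⟩ := h1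
      have h2 := hD.1 _ _ hw
      rcases w with w | j
      · simp [includeVertex] at h2
      · exact ⟨j, hw⟩
    obtain ⟨σ, hσ⟩ := exists_precedesInCycleWord_iff
      (f := fun x : Fin (m + n) => sortKey D (finSumFinEquiv.symm x))
      (sortKey_injective.comp finSumFinEquiv.symm.injective)
    have hσ' : ∀ x y, PrecedesInCycleWord σ (finSumFinEquiv x) (finSumFinEquiv y) ↔
        sortKey D x < sortKey D y := fun x y => by simpa using hσ (finSumFinEquiv x) (finSumFinEquiv y)
    refine ⟨σ, mem_excedanceClass_of_precedes hDo hDa hout hσ', ?_⟩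
    change addSink (orientationOfPerm σ) = D'
    rw [← hsink]
    congr 1
    ext u v
    change _ ∧ _ ↔ _
    rw [hσ']
    constructor
    · rintro ⟨h1, h2⟩
      exact (sortKey_lt_iff hDo hDa h1).1 h2
    · exact fun h1 => ⟨hDo.1 _ _ h1, sortKey_lt_of_adj hDo hDa h1⟩

end Excedance

/-! ### Independence of the number of orientations from the sink. -/

section Flip

variable {V : Type*} {G : SimpleGraph V} {D : Digraph V} {s t : V}

/-- Reverse all arrows between the vertices from which `t` can be reached and the others. -/
def flipAncestors (t : V) (D : Digraph V) : Digraph V where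
  Adj x y := (Relation.ReflTransGen D.Adj x t ↔ Relation.ReflTransGen D.Adj y t) ∧ D.Adj x y ∨
    ¬ (Relation.ReflTransGen D.Adj x t ↔ Relation.ReflTransGen D.Adj y t) ∧ D.Adj y x

theorem IsOrientationOf.flipAncestors (h : IsOrientationOf G D) (t : V) :
    IsOrientationOf G (flipAncestors t D) := by
  refine ⟨fun u v huv => ?_, fun u v huv => ?_⟩
  · rcases huv with huv | huv
    · exact h.1 _ _ huv.2
    · exact (h.1 _ _ huv.2).symm
  · have h1 := h.2 u v huv
    simp only [_root_.flipAncestors]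
    tauto

/-- The flipped arrows point from non-ancestors of `t` to ancestors. -/
theorem flipAncestors_adj {x y : V} (h : (flipAncestors t D).Adj x y) :
    D.Adj x y ∧ (Relation.ReflTransGen D.Adj x t ↔ Relation.ReflTransGen D.Adj y t) ∨
      D.Adj y x ∧ ¬ Relation.ReflTransGen D.Adj x t ∧ Relation.ReflTransGen D.Adj y t := by
  rcases h with ⟨h1, h2⟩ | ⟨h1, h2⟩
  · exact Or.inl ⟨h2, h1⟩
  · have : Relation.ReflTransGen D.Adj x t → Relation.ReflTransGen D.Adj y t :=
      fun h => h.head h2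
    tauto

/-- After the flip all arrows across the cut enter the set of ancestors of `t`. A directed cycle
could not come back, so it would stay on one side and be a cycle of `D`. -/
theorem IsAcyclicDigraph.flipAncestors (h : IsAcyclicDigraph D) (t : V) :
    IsAcyclicDigraph (flipAncestors t D) := by
  have key : ∀ x y, Relation.TransGen (_root_.flipAncestors t D).Adj x y →
      Relation.TransGen D.Adj x y ∧
        (Relation.ReflTransGen D.Adj x t ↔ Relation.ReflTransGen D.Adj y t) ∨
      ¬ Relation.ReflTransGen D.Adj x t ∧ Relation.ReflTransGen D.Adj y t := by
    intro x y hxy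
    induction hxy with
    | single h' =>
      rcases flipAncestors_adj h' with ⟨h1, h2⟩ | ⟨h1, h2⟩
      · exact Or.inl ⟨.single h1, h2⟩
      · exact Or.inr h2
    | tail _ h' ih =>
      rcases flipAncestors_adj h' with ⟨h1, h2⟩ | ⟨h1, h2⟩
      · rcases ih with ⟨h3, h4⟩ | h3
        · exact Or.inl ⟨h3.tail h1, h4.trans h2⟩
        · exact Or.inr ⟨h3.1, h2.1 h3.2⟩
      · rcases ih with ⟨h3, h4⟩ | h3
        · exact Or.inr ⟨fun h5 => h2.1 (h4.1 h5), h2.2⟩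
        · exact absurd h3.2 h2.1
  intro v hv
  rcases key v v hv with h1 | h1
  · exact h v h1.1
  · exact h1.1 h1.2

theorem reflTransGen_sink [Finite V] (hA : IsAcyclicDigraph D) (hs : ∀ v, IsSinkOf D v ↔ v = s)
    (x : V) : Relation.ReflTransGen D.Adj x s := by
  have : IsTrans V (Relation.TransGen (Function.swap D.Adj)) := ⟨fun _ _ _ => .trans⟩
  have : Std.Irrefl (Relation.TransGen (Function.swap D.Adj)) :=
    ⟨fun a ha => hA a (Relation.transGen_swap.1 ha)⟩
  have hwf := Finite.wellFounded_of_trans_of_irrefl (Relation.TransGen (Function.swap D.Adj))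
  induction x using hwf.induction with
  | _ x ih =>
    by_cases hx : x = s
    · rw [hx]
    · have h1 := (not_congr (hs x)).2 hx
      simp only [IsSinkOf, not_forall, not_not] at h1
      obtain ⟨w, hw⟩ := h1
      exact (ih w (.single hw)).head hw

theorem not_reflTransGen_of_sink (hs : IsSinkOf D s) (hst : s ≠ t) :
    ¬ Relation.ReflTransGen D.Adj s t := by
  intro h
  rcases Relation.ReflTransGen.cases_head h with h | ⟨c, h, -⟩
  · exact hst h
  · exact hs _ h

/-- After the flip the ancestors of the old sink are the non-ancestors of the new one. -/
theorem reflTransGen_flipAncestors [Finite V] (hA : IsAcyclicDigraph D)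
    (hs : ∀ v, IsSinkOf D v ↔ v = s) (hst : s ≠ t) (x : V) :
    Relation.ReflTransGen (flipAncestors t D).Adj x s ↔ ¬ Relation.ReflTransGen D.Adj x t := by
  have hst' := not_reflTransGen_of_sink ((hs s).2 rfl) hst
  constructor
  · intro h
    induction h using Relation.ReflTransGen.head_induction_on with
    | refl => exact hst'
    | head h1 _ ih =>
      rcases flipAncestors_adj h1 with h2 | h2
      · rwa [h2.2]
      · exact h2.2.1
  · intro h
    have h1 := reflTransGen_sink hA hs x
    clear hs
    induction h1 using Relation.ReflTransGen.head_induction_on with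
    | refl => exact .refl
    | head h1 _ ih =>
      have h2 : ¬ Relation.ReflTransGen D.Adj _ t := fun h3 => h (h3.head h1)
      exact (ih h2).head (Or.inl ⟨iff_of_false h h2, h1⟩)

/-- The two flips reverse the same cut, seen from its two sides. -/
theorem flipAncestors_flipAncestors [Finite V] (hA : IsAcyclicDigraph D)
    (hs : ∀ v, IsSinkOf D v ↔ v = s) (hst : s ≠ t) :
    flipAncestors s (flipAncestors t D) = D := by
  ext x y
  change (_ ↔ _) ∧ _ ∨ ¬ (_ ↔ _) ∧ _ ↔ _
  rw [reflTransGen_flipAncestors hA hs hst, reflTransGen_flipAncestors hA hs hst]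
  simp only [flipAncestors]
  tauto

/-- An ancestor of `t` other than `t` keeps an arrow on its path to `t`, and a non-ancestor other
than `s` keeps one on its path to `s`. The old sink `s` gains the arrow to `t`, which is where
adjacency enters. -/
theorem flipAncestors_mapsTo [Finite V] (hst : G.Adj s t) :
    Set.MapsTo (flipAncestors t) (acyclicOrientationsWithSink G s)
      (acyclicOrientationsWithSink G t) := by
  rintro D ⟨hD, hA, hs⟩
  refine ⟨hD.flipAncestors t, hA.flipAncestors t, fun v => ⟨fun hv => ?_, ?_⟩⟩
  · by_contra hvt
    by_cases h1 : Relation.ReflTransGen D.Adj v t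
    · rcases Relation.ReflTransGen.cases_head h1 with h2 | ⟨c, h2, h3⟩
      · exact hvt h2
      · exact hv c (Or.inl ⟨iff_of_true h1 h3, h2⟩)
    · rcases Relation.ReflTransGen.cases_head (reflTransGen_sink hA hs v) with rfl | ⟨c, h2, h3⟩
      · refine hv t (Or.inr ⟨fun h => h1 (h.2 .refl), ?_⟩)
        exact (hD.2 _ _ hst.symm).2 ((hs v).2 rfl t)
      · exact hv c (Or.inl ⟨iff_of_false h1 fun h4 => h1 (h4.head h2), h2⟩)
  · rintro rfl w hw
    rcases flipAncestors_adj hw with ⟨h1, h2⟩ | ⟨-, h2, -⟩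
    · have h3 := h2.1 .refl
      rcases Relation.reflTransGen_iff_eq_or_transGen.1 h3 with h4 | h4
      · exact (hD.1 _ _ h1).ne h4
      · exact hA _ (h4.head h1)
    · exact h2 .refl

theorem ncard_acyclicOrientationsWithSink_of_adj [Finite V] (hst : G.Adj s t) :
    (acyclicOrientationsWithSink G s).ncard = (acyclicOrientationsWithSink G t).ncard := by
  have hbij : Set.BijOn (flipAncestors t) (acyclicOrientationsWithSink G s)
      (acyclicOrientationsWithSink G t) :=
    Set.InvOn.bijOn (f' := flipAncestors s)
      ⟨fun D hD => flipAncestors_flipAncestors hD.2.1 hD.2.2 hst.ne,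
        fun D hD => flipAncestors_flipAncestors hD.2.1 hD.2.2 hst.ne'⟩
      (flipAncestors_mapsTo hst) (flipAncestors_mapsTo hst.symm)
  rw [← hbij.image_eq, hbij.injOn.ncard_image]

/-- The number of acyclic orientations with a given unique sink does not depend on the sink. -/
theorem ncard_acyclicOrientationsWithSink_of_connected [Finite V] (hG : G.Preconnected) (s t : V) :
    (acyclicOrientationsWithSink G s).ncard = (acyclicOrientationsWithSink G t).ncard := by
  obtain ⟨w⟩ := hG s t
  induction w with
  | nil => rfl
  | cons h _ ih => exact (ncard_acyclicOrientationsWithSink_of_adj h).trans ih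

theorem completeBipartiteGraph_preconnected {α β : Type*} [Nonempty α] [Nonempty β] :
    (completeBipartiteGraph α β).Preconnected := by
  obtain ⟨a⟩ := ‹Nonempty α›
  obtain ⟨b⟩ := ‹Nonempty β›
  have hl : ∀ a', (completeBipartiteGraph α β).Reachable (Sum.inl a') (Sum.inr b) :=
    fun a' => SimpleGraph.Adj.reachable (by simp)
  have hr : ∀ b', (completeBipartiteGraph α β).Reachable (Sum.inl a) (Sum.inr b') :=
    fun b' => SimpleGraph.Adj.reachable (by simp)
  have h : ∀ x, (completeBipartiteGraph α β).Reachable x (Sum.inr b) := by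
    rintro (x | x)
    · exact hl x
    · exact (hr x).symm.trans (hl a)
  exact fun x y => (h x).trans (h y).symm

end Flip

/-! ### The sorting network on a grid. -/

section Network

variable {α : Type*} [LinearOrder α]

/-- The value carried along a row of comparators past the first `j` of the values `c`. -/
def carryMax (c : ℕ → α) (x : α) : ℕ → α
  | 0 => x
  | j + 1 => max (carryMax c x j) (c j)

/-- The values on the column wires of the sorting network with row inputs `R` and column inputs `C`
above its row `i`. -/
def colWire (R C : ℕ → α) : ℕ → ℕ → α
  | 0 => C
  | i + 1 => fun j => min (carryMax (colWire R C i) (R i) j) (colWire R C i j)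

/-- The value on the wire of row `i` before its comparator `j`. -/
def rowWire (R C : ℕ → α) (i j : ℕ) : α := carryMax (colWire R C i) (R i) j

variable {R C : ℕ → α}

theorem rowWire_succ (i j : ℕ) :
    rowWire R C i (j + 1) = max (rowWire R C i j) (colWire R C i j) := rfl

theorem colWire_succ (i j : ℕ) :
    colWire R C (i + 1) j = min (rowWire R C i j) (colWire R C i j) := rfl

theorem rowWire_mono (i : ℕ) : Monotone (rowWire R C i) :=
  monotone_nat_of_le_succ fun _ => le_max_left _ _

/-- Transposing the grid and reversing the order exchange rows with columns and `max` with `min`;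
facts about rows thus transfer to columns. -/
theorem wires_dual (R C : ℕ → α) (i j : ℕ) :
    rowWire (α := αᵒᵈ) (OrderDual.toDual ∘ C) (OrderDual.toDual ∘ R) j i =
        OrderDual.toDual (colWire R C i j) ∧
      colWire (α := αᵒᵈ) (OrderDual.toDual ∘ C) (OrderDual.toDual ∘ R) j i =
        OrderDual.toDual (rowWire R C i j) := by
  induction i generalizing j with
  | zero =>
    induction j with
    | zero => exact ⟨rfl, rfl⟩
    | succ j ih =>
      refine ⟨rfl, ?_⟩
      rw [colWire_succ, ih.1, ih.2, rowWire_succ, max_comm]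
      rfl
  | succ i ihi =>
    have h1 : ∀ j, rowWire (α := αᵒᵈ) (OrderDual.toDual ∘ C) (OrderDual.toDual ∘ R) j (i + 1) =
        OrderDual.toDual (colWire R C (i + 1) j) := fun j => by
      rw [rowWire_succ, (ihi j).1, (ihi j).2, colWire_succ, min_comm]
      rfl
    refine ⟨h1 j, ?_⟩
    induction j with
    | zero => rfl
    | succ j ih =>
      rw [colWire_succ, h1, ih, rowWire_succ, max_comm]
      rfl

theorem rowWire_conserved {i k q : ℕ} (hk : k ≤ q) :
    rowWire R C i q = rowWire R C i k ∨
      ∃ j, k ≤ j ∧ j < q ∧ colWire R C (i + 1) j = rowWire R C i k := by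
  induction q, hk using Nat.le_induction with
  | base => exact Or.inl rfl
  | succ q hk ih =>
    rcases ih with ih | ⟨j, h1, h2, h3⟩
    · rcases le_total (rowWire R C i q) (colWire R C i q) with h | h
      · exact Or.inr ⟨q, hk, by omega, by rw [colWire_succ, min_eq_left h, ih]⟩
      · exact Or.inl (by rw [rowWire_succ, max_eq_left h, ih])
    · exact Or.inr ⟨j, h1, by omega, h3⟩

theorem colWire_conserved {i j q : ℕ} (hj : j < q) :
    rowWire R C i q = colWire R C i j ∨ ∃ j' < q, colWire R C (i + 1) j' = colWire R C i j := by
  rcases le_total (rowWire R C i j) (colWire R C i j) with h | h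
  · have h1 : colWire R C i j = rowWire R C i (j + 1) := by rw [rowWire_succ, max_eq_right h]
    rw [h1]
    exact (rowWire_conserved hj).imp_right fun ⟨j', h2, h3, h4⟩ => ⟨j', h3, h4⟩
  · exact Or.inr ⟨j, hj, by rw [colWire_succ, min_eq_right h]⟩

theorem le_rowWire_of_colWire {i j q : ℕ} (hj : j < q) : colWire R C i j ≤ rowWire R C i q :=
  (le_max_right _ _).trans (rowWire_mono (R := R) (C := C) i (Nat.succ_le_of_lt hj))

/-- A value on a column wire above row `i` leaves the network in a row from `i` on or in a
column. -/
theorem colWire_mem_output {i j p q : ℕ} (hi : i ≤ p) (hj : j < q) :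
    (∃ i', i ≤ i' ∧ i' < p ∧ rowWire R C i' q = colWire R C i j) ∨
      ∃ j' < q, colWire R C p j' = colWire R C i j := by
  induction p, hi using Nat.le_induction with
  | base => exact Or.inr ⟨j, hj, rfl⟩
  | succ p hp ih =>
    rcases ih with ⟨i', h1, h2, h3⟩ | ⟨j', h1, h2⟩
    · exact Or.inl ⟨i', h1, by omega, h3⟩
    · rw [← h2]
      rcases colWire_conserved (R := R) (C := C) (i := p) h1 with h3 | h3
      · exact Or.inl ⟨p, hp, by omega, h3⟩
      · exact Or.inr h3

/-- An input of row `i` leaves the network in a row from `i` on or in a column. -/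
theorem rowInput_mem_output {i p q : ℕ} (hi : i < p) :
    (∃ i', i ≤ i' ∧ i' < p ∧ rowWire R C i' q = R i) ∨ ∃ j' < q, colWire R C p j' = R i := by
  rcases rowWire_conserved (R := R) (C := C) (i := i) (Nat.zero_le q) with h | ⟨j, -, h1, h2⟩
  · exact Or.inl ⟨i, le_rfl, hi, h⟩
  · have h3 : colWire R C (i + 1) j = R i := h2
    rw [← h3]
    exact (colWire_mem_output (R := R) (C := C) hi h1).imp_left
      fun ⟨i', h4, h5, h6⟩ => ⟨i', by omega, h5, h6⟩

/-- If the targets `T` decrease from the largest value on, and none of them enters in too late a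
row, they are the outputs of the rows. -/
theorem rowWire_eq_of_inputs {p q : ℕ} {T : ℕ → α}
    (hinj : ∀ i i', i < p → i' < p → rowWire R C i q = rowWire R C i' q → i = i')
    (hTne : ∀ i i', i < i' → i' < p → T i ≠ T i') (hT : ∀ i < p, ∀ x, (∀ i' < i, x ≠ T i') → x ≤ T i)
    (hin : ∀ i < p, (∃ j < q, C j = T i) ∨ ∃ i' ≤ i, R i' = T i) :
    ∀ i < p, rowWire R C i q = T i := by
  intro i
  induction i using Nat.strong_induction_on with
  | _ i ih =>
    intro hi
    -- Above row `k` the target `T i` is on a column wire or still to enter: an earlier row `k`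
    -- emits `T k`, hence cannot have emitted `T i`.
    have key : ∀ k ≤ i, (∃ j < q, colWire R C k j = T i) ∨ ∃ i', k ≤ i' ∧ i' ≤ i ∧ R i' = T i := by
      intro k
      induction k with
      | zero => exact fun _ => (hin i hi).imp_right fun ⟨i', h1, h2⟩ => ⟨i', Nat.zero_le _, h1, h2⟩
      | succ k ihk =>
        intro hk
        have hne : rowWire R C k q ≠ T i := by
          rw [ih k hk (lt_trans hk hi)]
          exact hTne k i hk hi
        rcases ihk (by omega) with ⟨j, hj, h⟩ | ⟨i', h1, h2, h3⟩
        · rcases colWire_conserved (R := R) (C := C) (i := k) hj with h4 | ⟨j', h4, h5⟩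
          · exact absurd (h4.trans h) hne
          · exact Or.inl ⟨j', h4, h5.trans h⟩
        · rcases eq_or_lt_of_le h1 with rfl | h1
          · rcases rowWire_conserved (R := R) (C := C) (i := k) (Nat.zero_le q) with h4 | ⟨j, -, h4, h5⟩
            · exact absurd (h4.trans h3) hne
            · exact Or.inl ⟨j, h4, h5.trans h3⟩
          · exact Or.inr ⟨i', h1, h2, h3⟩
    refine le_antisymm (hT i hi _ fun i' h' h'' => ?_) ?_
    · rw [← ih i' h' (h'.trans hi)] at h''
      exact h'.ne' (hinj _ _ hi (h'.trans hi) h'')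
    · rcases key i le_rfl with ⟨j, hj, h⟩ | ⟨i', h1, h2, h3⟩
      · exact h ▸ le_rowWire_of_colWire hj
      · obtain rfl := le_antisymm h1 h2
        rw [← h3]
        exact rowWire_mono (R := R) (C := C) i (Nat.zero_le q)

end Network

/-! ### Toppling as a run of the network. -/

theorem bijective_of_swap {α β : Type*} [DecidableEq α] {f g : α → β} (hf : Function.Bijective f)
    {a b : α} (hne : ∀ x, x ≠ a → x ≠ b → g x = f x)
    (h : (g a = f a ∧ g b = f b) ∨ (g a = f b ∧ g b = f a)) : Function.Bijective g := by
  rcases h with h | h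
  · convert hf using 1
    ext x
    by_cases h1 : x = a
    · rw [h1, h.1]
    by_cases h2 : x = b
    · rw [h2, h.2]
    exact hne x h1 h2
  · convert hf.comp (Equiv.swap a b).bijective using 1
    ext x
    rw [Function.comp_apply, Equiv.swap_apply_def]
    grind

section Toppling

variable {k p q : ℕ} (R C : ℕ → Fin k)

/-- The chip on each wire once row `i` has passed `lam i` and column `j` has passed `mu j`
comparators. -/
def wireChip (lam : Fin p → ℕ) (mu : Fin q → ℕ) : Fin p ⊕ Fin q → Fin k :=
  Sum.elim (fun i => rowWire R C i (lam i)) (fun j => colWire R C (mu j) j)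

/-- The site of the chip on each wire. -/
def wireSite (lam : Fin p → ℕ) (mu : Fin q → ℕ) : Fin p ⊕ Fin q → ℤ :=
  Sum.elim (fun i => (lam i : ℤ) - (i : ℕ)) (fun j => ((j : ℕ) : ℤ) - mu j)

/-- The configuration `c` occurs when the comparators `(i, j)` with `j < lam i`, equivalently
`i < mu j`, have been passed. -/
structure IsStage (lam : Fin p → ℕ) (mu : Fin q → ℕ) (c : Fin k → ℤ) : Prop where
  lt_iff : ∀ (i : Fin p) (j : Fin q), (j : ℕ) < lam i ↔ (i : ℕ) < mu j
  lam_le : ∀ i, lam i ≤ q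
  mu_le : ∀ j, mu j ≤ p
  bij : Function.Bijective (wireChip R C lam mu)
  site : ∀ w, c (wireChip R C lam mu w) = wireSite lam mu w

variable {R C} {lam : Fin p → ℕ} {mu : Fin q → ℕ} {c d : Fin k → ℤ}

/-- The larger chip `β` stays on the row wire, whose site moves right, and the smaller chip `α` on
the column wire, whose site moves left, whichever of the two arrived on which wire. -/
theorem IsStage.step (h : IsStage R C lam mu c) {i : Fin p} {j : Fin q} (hi : lam i = j)
    (hj : mu j = i) {α β : Fin k} (hαβ : α < β) (hc : c α = c β)
    (hw : (rowWire R C i j = α ∧ colWire R C i j = β) ∨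
      (rowWire R C i j = β ∧ colWire R C i j = α)) :
    IsStage R C (Function.update lam i (j + 1)) (Function.update mu j (i + 1))
      (Function.update (Function.update c α (c α - 1)) β (c β + 1)) := by
  have hrow : wireChip R C lam mu (Sum.inl i) = rowWire R C i j := by simp [wireChip, hi]
  have hcol : wireChip R C lam mu (Sum.inr j) = colWire R C i j := by simp [wireChip, hj]
  set lam' := Function.update lam i (j + 1) with hlam
  set mu' := Function.update mu j (i + 1) with hmu
  have hrow' : wireChip R C lam' mu' (Sum.inl i) = β := by
    simp only [wireChip, Sum.elim_inl, hlam, Function.update_self, rowWire_succ]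
    rcases hw with ⟨h1, h2⟩ | ⟨h1, h2⟩ <;> rw [h1, h2]
    · exact max_eq_right hαβ.le
    · exact max_eq_left hαβ.le
  have hcol' : wireChip R C lam' mu' (Sum.inr j) = α := by
    simp only [wireChip, Sum.elim_inr, hmu, Function.update_self, colWire_succ]
    rcases hw with ⟨h1, h2⟩ | ⟨h1, h2⟩ <;> rw [h1, h2]
    · exact min_eq_left hαβ.le
    · exact min_eq_right hαβ.le
  have hother : ∀ w, w ≠ Sum.inl i → w ≠ Sum.inr j →
      wireChip R C lam' mu' w = wireChip R C lam mu w ∧ wireSite lam' mu' w = wireSite lam mu w := by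
    rintro (w | w) h1 h2
    · have : w ≠ i := fun h => h1 (by rw [h])
      simp [wireChip, wireSite, hlam, this]
    · have : w ≠ j := fun h => h2 (by rw [h])
      simp [wireChip, wireSite, hmu, this]
  have hcα : c α = (j : ℕ) - (i : ℕ) := by
    have h1 := h.site (Sum.inl i)
    rw [hrow] at h1
    have h2 : c (rowWire R C i j) = c α := by
      rcases hw with ⟨h1, h2⟩ | ⟨h1, h2⟩ <;> rw [h1, hc]
    rw [← h2, h1]
    simp [wireSite, hi]
  refine ⟨fun i' j' => ?_, fun i' => ?_, fun j' => ?_, ?_, fun w => ?_⟩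
  · have h1 := h.lt_iff i' j'
    have h2 := h.lt_iff i' j
    have h3 := h.lt_iff i j'
    rcases eq_or_ne i' i with rfl | hi' <;> rcases eq_or_ne j' j with rfl | hj'
    · simp [hlam, hmu]
    · have := Fin.val_ne_of_ne hj'
      simp only [hlam, hmu, Function.update_self, Function.update_of_ne hj']
      omega
    · have := Fin.val_ne_of_ne hi'
      simp only [hlam, hmu, Function.update_self, Function.update_of_ne hi']
      omega
    · simpa only [hlam, hmu, Function.update_of_ne hi', Function.update_of_ne hj'] using h1
  · rcases eq_or_ne i' i with rfl | hi'
    · simp only [hlam, Function.update_self]; omega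
    · simpa only [hlam, Function.update_of_ne hi'] using h.lam_le i'
  · rcases eq_or_ne j' j with rfl | hj'
    · simp only [hmu, Function.update_self]; omega
    · simpa only [hmu, Function.update_of_ne hj'] using h.mu_le j'
  · refine bijective_of_swap h.bij (a := Sum.inl i) (b := Sum.inr j)
      (fun w h1 h2 => (hother w h1 h2).1) ?_
    rw [hrow', hcol', hrow, hcol]
    rcases hw with ⟨h1, h2⟩ | ⟨h1, h2⟩
    · exact Or.inr ⟨h2.symm, h1.symm⟩
    · exact Or.inl ⟨h1.symm, h2.symm⟩
  · by_cases h1 : w = Sum.inl i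
    · rw [h1, hrow', Function.update_self, ← hc, hcα]
      simp [wireSite, hlam]
      ring
    by_cases h2 : w = Sum.inr j
    · rw [h2, hcol', Function.update_of_ne hαβ.ne, Function.update_self, hcα]
      simp [wireSite, hmu]
      ring
    rw [(hother w h1 h2).1, (hother w h1 h2).2, ← h.site]
    have h3 : wireChip R C lam mu w ≠ rowWire R C i j := by
      rw [← hrow]; exact fun h' => h1 (h.bij.1 h')
    have h4 : wireChip R C lam mu w ≠ colWire R C i j := by
      rw [← hcol]; exact fun h' => h2 (h.bij.1 h')
    rw [Function.update_of_ne, Function.update_of_ne] <;> grind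

/-- Equal sites mean `lam i + mu j = i + j`. By the staircase condition the two summands on the left
both exceed their counterparts `j` and `i`, or neither does. -/
theorem IsStage.eq_of_site_eq (h : IsStage R C lam mu c) {i : Fin p} {j : Fin q}
    (hs : wireSite lam mu (Sum.inl i) = wireSite lam mu (Sum.inr j)) : lam i = j ∧ mu j = i := by
  have h1 := h.lt_iff i j
  simp only [wireSite, Sum.elim_inl, Sum.elim_inr] at hs
  omega

theorem IsStage.rowSite_injective (h : IsStage R C lam mu c) {i i' : Fin p}
    (hs : wireSite lam mu (Sum.inl i) = wireSite lam mu (Sum.inl i')) : i = i' := by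
  have key : ∀ i i' : Fin p, i < i' → wireSite lam mu (Sum.inl i) ≠ wireSite lam mu (Sum.inl i') := by
    intro i i' hlt hs
    simp only [wireSite, Sum.elim_inl] at hs
    have h1 := h.lam_le i'
    -- Then column `lam i` would have passed row `i'` but not the earlier row `i`.
    have h2 : lam i < lam i' := by omega
    have h3 := h.lt_iff i ⟨lam i, by omega⟩
    have h4 := h.lt_iff i' ⟨lam i, by omega⟩
    simp only at h3 h4
    omega
  rcases lt_trichotomy i i' with h1 | h1 | h1
  · exact absurd hs (key _ _ h1)
  · exact h1
  · exact absurd hs.symm (key _ _ h1)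

theorem IsStage.colSite_injective (h : IsStage R C lam mu c) {j j' : Fin q}
    (hs : wireSite lam mu (Sum.inr j) = wireSite lam mu (Sum.inr j')) : j = j' := by
  have key : ∀ j j' : Fin q, j < j' → wireSite lam mu (Sum.inr j) ≠ wireSite lam mu (Sum.inr j') := by
    intro j j' hlt hs
    simp only [wireSite, Sum.elim_inr] at hs
    have h1 := h.mu_le j'
    have h2 : mu j < mu j' := by omega
    have h3 := h.lt_iff ⟨mu j, by omega⟩ j
    have h4 := h.lt_iff ⟨mu j, by omega⟩ j'
    simp only at h3 h4
    omega
  rcases lt_trichotomy j j' with h1 | h1 | h1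
  · exact absurd hs (key _ _ h1)
  · exact h1
  · exact absurd hs.symm (key _ _ h1)

/-- Toppling moves pass one comparator. -/
theorem IsStage.of_toppleStep (h : IsStage R C lam mu c) (hd : ToppleStep c d) :
    ∃ (lam' : Fin p → ℕ) (mu' : Fin q → ℕ), IsStage R C lam' mu' d := by
  obtain ⟨α, β, hαβ, hc, rfl⟩ := hd
  obtain ⟨w, hw⟩ := h.bij.2 α
  obtain ⟨w', hw'⟩ := h.bij.2 β
  have hs : wireSite lam mu w = wireSite lam mu w' := by rw [← h.site, ← h.site, hw, hw', hc]
  have hne : w ≠ w' := fun h' => hαβ.ne (by rw [← hw, ← hw', h'])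
  rcases w with i | j <;> rcases w' with i' | j'
  · exact absurd (by rw [h.rowSite_injective hs]) hne
  · obtain ⟨h1, h2⟩ := h.eq_of_site_eq hs
    simp only [wireChip, Sum.elim_inl, Sum.elim_inr, h1, h2] at hw hw'
    exact ⟨_, _, h.step h1 h2 hαβ hc (Or.inl ⟨hw, hw'⟩)⟩
  · obtain ⟨h1, h2⟩ := h.eq_of_site_eq hs.symm
    simp only [wireChip, Sum.elim_inl, Sum.elim_inr, h1, h2] at hw hw'
    exact ⟨_, _, h.step h1 h2 hαβ hc (Or.inr ⟨hw', hw⟩)⟩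
  · exact absurd (by rw [h.colSite_injective hs]) hne

theorem IsStage.of_reflTransGen (h : IsStage R C lam mu c)
    (hd : Relation.ReflTransGen ToppleStep c d) :
    ∃ (lam' : Fin p → ℕ) (mu' : Fin q → ℕ), IsStage R C lam' mu' d := by
  induction hd with
  | refl => exact ⟨_, _, h⟩
  | tail _ h' ih =>
    obtain ⟨_, _, h1⟩ := ih
    exact h1.of_toppleStep h'

theorem IsStage.exists_corner (h : IsStage R C lam mu c) (hl : ∃ i, lam i < q) :
    ∃ (i : Fin p) (j : Fin q), lam i = j ∧ mu j = i := by
  -- In the first unfinished row the next comparator is ready: a column lagging behind would leave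
  -- an earlier row unfinished.
  obtain ⟨i, hi, hmin⟩ := WellFounded.has_min (wellFounded_lt (α := Fin p)) {i | lam i < q} hl
  refine ⟨i, ⟨lam i, hi⟩, rfl, ?_⟩
  have h1 := h.lt_iff i ⟨lam i, hi⟩
  simp only [lt_irrefl, false_iff, not_lt] at h1
  by_contra h2
  have h3 : mu ⟨lam i, hi⟩ < i := lt_of_le_of_ne h1 h2
  have h4 := h.lt_iff ⟨mu ⟨lam i, hi⟩, by omega⟩ ⟨lam i, hi⟩
  simp only [lt_irrefl, iff_false, not_lt] at h4
  exact hmin ⟨mu ⟨lam i, hi⟩, by omega⟩ (h4.trans_lt hi) h3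

/-- An unfinished stage has a corner, where two chips share a site. Every final configuration is
therefore the full output of the network, whatever the choices. -/
theorem IsStage.lam_eq_of_isFinal (h : IsStage R C lam mu c) (hc : IsFinal c) :
    lam = (fun _ => q) ∧ mu = fun _ => p := by
  have hl : ∀ i, lam i = q := by
    by_contra! hl
    obtain ⟨i, hi⟩ := hl
    obtain ⟨i, j, h1, h2⟩ := h.exists_corner ⟨i, lt_of_le_of_ne (h.lam_le i) hi⟩
    have h3 : wireSite lam mu (Sum.inl i) = wireSite lam mu (Sum.inr j) := by
      simp [wireSite, h1, h2]
    rw [← h.site, ← h.site] at h3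
    simpa using h.bij.1 (hc h3)
  refine ⟨funext hl, funext fun j => le_antisymm (h.mu_le j) ?_⟩
  by_contra! h1
  have h2 := h.lt_iff ⟨mu j, h1⟩ j
  simp [hl] at h2

theorem IsStage.exists_isFinal (h : IsStage R C lam mu c) :
    ∃ d, Relation.ReflTransGen ToppleStep c d ∧ IsFinal d := by
  -- The number of comparators not yet passed drops at each move.
  induction hk : p * q - ∑ i, lam i using Nat.strong_induction_on generalizing lam mu c with
  | _ k ih =>
    by_cases hc : IsFinal c
    · exact ⟨c, .refl, hc⟩
    · have hex : ∃ (i : Fin p) (j : Fin q), lam i = j ∧ mu j = i := by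
        by_contra hno
        push Not at hno
        refine hc fun α β hαβ => ?_
        obtain ⟨w, rfl⟩ := h.bij.2 α
        obtain ⟨w', rfl⟩ := h.bij.2 β
        rw [h.site, h.site] at hαβ
        congr 1
        rcases w with i | j <;> rcases w' with i' | j'
        · rw [h.rowSite_injective hαβ]
        · exact absurd (h.eq_of_site_eq hαβ).2 (hno _ _ (h.eq_of_site_eq hαβ).1)
        · exact absurd (h.eq_of_site_eq hαβ.symm).2 (hno _ _ (h.eq_of_site_eq hαβ.symm).1)
        · rw [h.colSite_injective hαβ]
      obtain ⟨i, j, h1, h2⟩ := hex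
      have h3 : c (rowWire R C i j) = c (colWire R C i j) := by
        have h4 := h.site (Sum.inl i)
        have h5 := h.site (Sum.inr j)
        simp only [wireChip, wireSite, Sum.elim_inl, Sum.elim_inr, h1, h2] at h4 h5
        rw [h4, h5]
      have h4 : rowWire R C i j ≠ colWire R C i j := fun h4 => by
        have h5 : wireChip R C lam mu (Sum.inl i) = wireChip R C lam mu (Sum.inr j) := by
          simpa [wireChip, h1, h2] using h4
        simpa using h.bij.1 h5
      have key : ∀ d, IsStage R C (Function.update lam i (j + 1)) (Function.update mu j (i + 1)) d →
          ∃ e, Relation.ReflTransGen ToppleStep d e ∧ IsFinal e := fun d hd => by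
        refine ih _ ?_ hd rfl
        have h5 : ∑ x, Function.update lam i (j + 1) x ≤ p * q := by
          simpa using Finset.sum_le_card_nsmul Finset.univ _ q fun x _ => hd.lam_le x
        have h6 : ∑ x, lam x < ∑ x, Function.update lam i (j + 1) x := by
          refine Finset.sum_lt_sum (fun x _ => ?_) ⟨i, Finset.mem_univ _, by simp [h1]⟩
          rcases eq_or_ne x i with rfl | hx
          · simp [h1]
          · simp [hx]
        omega
      rcases lt_or_gt_of_ne h4 with h5 | h5
      · obtain ⟨e, he, he'⟩ := key _ (h.step h1 h2 h5 h3 (Or.inl ⟨rfl, rfl⟩))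
        exact ⟨e, he.head ⟨_, _, h5, h3, rfl⟩, he'⟩
      · obtain ⟨e, he, he'⟩ := key _ (h.step h1 h2 h5 h3.symm (Or.inr ⟨rfl, rfl⟩))
        exact ⟨e, he.head ⟨_, _, h5, h3.symm, rfl⟩, he'⟩

end Toppling

/-! ### When the output of the network is sorted. -/

section Sorted

variable {k p q : ℕ} {R C : ℕ → Fin (k + 1)} {d : Fin (k + 1) → ℤ}

/-- The position, from the left, of the chip on the given wire when toppling has ended. -/
def wireRank (k : ℕ) : Fin p ⊕ Fin q → ℕ := Sum.elim (fun i => k - i) (fun j => j)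

/-- In the end the columns occupy the sites `-p, …, q - p - 1` and the rows, in reverse, `q - p + 1,
…, q`; only `q - p` in between is empty. -/
theorem wireRank_lt_iff (hpq : p + q = k + 1) (w w' : Fin p ⊕ Fin q) :
    wireRank k w < wireRank k w' ↔
      wireSite (fun _ => q) (fun _ => p) w < wireSite (fun _ => q) (fun _ => p) w' := by
  rcases w with i | j <;> rcases w' with i' | j' <;>
    simp only [wireRank, wireSite, Sum.elim_inl, Sum.elim_inr] <;> omega

theorem wireRank_injective (hpq : p + q = k + 1) :
    Function.Injective (wireRank k : Fin p ⊕ Fin q → ℕ) := by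
  intro w w' h
  rcases w with i | j <;> rcases w' with i' | j' <;>
    simp only [wireRank, Sum.elim_inl, Sum.elim_inr] at h <;>
    first
    | (exfalso; omega)
    | (congr 1; ext; omega)

theorem wireRank_lt (hpq : p + q = k + 1) (w : Fin p ⊕ Fin q) : wireRank k w < k + 1 := by
  rcases w with i | j <;> simp only [wireRank, Sum.elim_inl, Sum.elim_inr] <;> omega

theorem IsStage.strictMono_iff (hpq : p + q = k + 1)
    (h : IsStage R C (fun _ : Fin p => q) (fun _ : Fin q => p) d) :
    StrictMono d ↔ ∀ w, (wireChip R C (fun _ : Fin p => q) (fun _ : Fin q => p) w : ℕ) =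
      wireRank k w := by
  constructor
  · intro hd
    let e := Equiv.ofBijective _ h.bij
    let t : Fin p ⊕ Fin q → Fin (k + 1) := fun w => ⟨wireRank k w, wireRank_lt hpq w⟩
    have ht : Function.Injective t := fun w w' h' =>
      wireRank_injective hpq (congrArg Fin.val h')
    have hmono : StrictMono (t ∘ e.symm) := by
      intro x y hxy
      obtain ⟨w, rfl⟩ := e.surjective x
      obtain ⟨w', rfl⟩ := e.surjective y
      have h1 := hd hxy
      change d (wireChip R C _ _ w) < d (wireChip R C _ _ w') at h1
      rw [h.site, h.site] at h1
      simpa [t, wireRank_lt_iff hpq] using h1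
    have hsurj : Function.Surjective (t ∘ e.symm) :=
      Finite.surjective_of_injective (ht.comp e.symm.injective)
    have hid : t ∘ e.symm = id :=
      (StrictMono.range_inj hmono strictMono_id).1 (by rw [hsurj.range_eq, Set.range_id])
    intro w
    have h1 := congrFun hid (e w)
    simp only [Function.comp_apply, Equiv.symm_apply_apply, id] at h1
    exact (congrArg Fin.val h1).symm
  · intro hw x y hxy
    obtain ⟨w, rfl⟩ := h.bij.2 x
    obtain ⟨w', rfl⟩ := h.bij.2 y
    rw [h.site, h.site, ← wireRank_lt_iff hpq, ← hw, ← hw]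
    exact hxy

/-- A value entering a row can leave only by that row, a later one, or a column, so it must not
enter after the row assigned to it. This suffices by `rowWire_eq_of_inputs`, since row `i` is
assigned the largest label left. Columns follow by duality. -/
theorem wireChip_eq_wireRank_iff (hpq : p + q = k + 1)
    (hinit : Function.Bijective (wireChip R C (fun _ : Fin p => 0) (fun _ : Fin q => 0)))
    (hfull : Function.Bijective (wireChip R C (fun _ : Fin p => q) (fun _ : Fin q => p))) :
    (∀ w, (wireChip R C (fun _ : Fin p => q) (fun _ : Fin q => p) w : ℕ) = wireRank k w) ↔
      (∀ i < p, ∀ i' < p, (R i' : ℕ) = k - i → i' ≤ i) ∧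
        ∀ j < q, ∀ j' < q, (C j' : ℕ) = j → j' ≤ j := by
  have hrr : ∀ i i', i < p → i' < p → rowWire R C i q = rowWire R C i' q → i = i' :=
    fun i i' hi hi' h => by
      have h1 := @hfull.1 (Sum.inl ⟨i, hi⟩) (Sum.inl ⟨i', hi'⟩) h
      simpa using h1
  have hcc : ∀ j j', j < q → j' < q → colWire R C p j = colWire R C p j' → j = j' :=
    fun j j' hj hj' h => by
      have h1 := @hfull.1 (Sum.inr ⟨j, hj⟩) (Sum.inr ⟨j', hj'⟩) h
      simpa using h1
  have hrc : ∀ i j, i < p → j < q → rowWire R C i q ≠ colWire R C p j := fun i j hi hj h => by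
    have h1 := @hfull.1 (Sum.inl ⟨i, hi⟩) (Sum.inr ⟨j, hj⟩) h
    simp at h1
  have hin : ∀ x, (∃ i < p, R i = x) ∨ ∃ j < q, C j = x := fun x => by
    obtain ⟨i | j, hw⟩ := hinit.2 x
    · exact Or.inl ⟨i, i.2, hw⟩
    · exact Or.inr ⟨j, j.2, hw⟩
  constructor
  · intro h
    refine ⟨fun i hi i' hi' heq => ?_, fun j hj j' hj' heq => ?_⟩
    · have h1 : rowWire R C i q = R i' := Fin.ext ((h (Sum.inl ⟨i, hi⟩)).trans heq.symm)
      rcases rowInput_mem_output (R := R) (C := C) (q := q) hi' with ⟨i'', h2, h3, h4⟩ | ⟨j, h2, h3⟩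
      · rwa [hrr i i'' hi h3 (h1.trans h4.symm)]
      · exact absurd (h1.trans h3.symm) (hrc i j hi h2)
    · have h1 : colWire R C p j = C j' := Fin.ext ((h (Sum.inr ⟨j, hj⟩)).trans heq.symm)
      rcases rowInput_mem_output (α := (Fin (k + 1))ᵒᵈ) (R := OrderDual.toDual ∘ C)
        (C := OrderDual.toDual ∘ R) (q := p) hj' with ⟨j'', h2, h3, h4⟩ | ⟨i, h2, h3⟩
      · rw [(wires_dual R C p j'').1] at h4
        rwa [hcc j j'' hj h3 (h1.trans h4.symm)]
      · rw [(wires_dual R C i q).2] at h3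
        exact absurd (h3.trans h1.symm) (hrc i j h2 hj)
  · rintro ⟨hR, hC⟩ (i | j)
    · have key := rowWire_eq_of_inputs (R := R) (C := C) (p := p) (q := q)
        (T := fun i => ⟨k - i, by omega⟩) hrr
        (fun i i' h1 h2 h3 => by simp only [Fin.mk.injEq] at h3; omega)
        (fun i hi x hx => by
          rw [Fin.le_def]
          by_contra! h1
          exact hx (k - x) (by simp only at h1; omega) (Fin.ext (by simp only; omega)))
        (fun i hi => by
          rcases hin ⟨k - i, by omega⟩ with ⟨i', h1, h2⟩ | h1
          · exact Or.inr ⟨i', hR i hi i' h1 (congrArg Fin.val h2), h2⟩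
          · exact Or.inl h1)
      exact congrArg Fin.val (key i i.2)
    · have key := rowWire_eq_of_inputs (α := (Fin (k + 1))ᵒᵈ) (R := OrderDual.toDual ∘ C)
        (C := OrderDual.toDual ∘ R) (p := q) (q := p)
        -- The cap at `k` only makes the target defined for all `j`; it does nothing for `j < q`.
        (T := fun j => OrderDual.toDual ⟨min j k, by omega⟩)
        (fun j j' hj hj' h => by
          rw [(wires_dual R C p j).1, (wires_dual R C p j').1] at h
          exact hcc j j' hj hj' h)
        (fun i i' h1 h2 h3 => by
          simp only [EmbeddingLike.apply_eq_iff_eq, Fin.mk.injEq] at h3; omega)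
        (fun j hj x hx => by
          change (⟨min j k, _⟩ : Fin (k + 1)) ≤ OrderDual.ofDual x
          rw [Fin.le_def]
          by_contra! h1
          refine hx (OrderDual.ofDual x : Fin (k + 1)) (by simp only at h1; omega) ?_
          change OrderDual.ofDual x = _
          exact Fin.ext (by
            have := (OrderDual.ofDual x : Fin (k + 1)).2
            change _ = min _ _
            omega))
        (fun j hj => by
          rcases hin ⟨min j k, by omega⟩ with ⟨i', h1, h2⟩ | ⟨j', h1, h2⟩
          · exact Or.inl ⟨i', h1, congrArg OrderDual.toDual h2⟩
          · refine Or.inr ⟨j', hC j hj j' h1 ?_, congrArg OrderDual.toDual h2⟩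
            rw [h2]
            exact min_eq_left (by omega))
      have h1 := key j j.2
      rw [(wires_dual R C p j).1] at h1
      refine (congrArg Fin.val (OrderDual.toDual.injective h1)).trans ?_
      change min _ _ = (j : ℕ)
      omega

theorem eq_one_of_strictMono {n : ℕ} {τ : Perm (Fin n)} (h : StrictMono τ) : τ = 1 := by
  have h1 : (τ : Fin n → Fin n) = id :=
    (StrictMono.range_inj h strictMono_id).1 (by rw [τ.surjective.range_eq, Set.range_id])
  ext x
  rw [h1]
  rfl

end Sorted

/-! ### Toppleable permutations, bounded displacement and excedances. -/

section Toppleable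

variable {m q : ℕ}

/-- The chips that enter the rows of the sorting network: the additional chip, and those at the
sites `-1, …, -m`. -/
def rowInput (π : Perm (Fin (m + q))) (r : Fin (m + q + 1)) (i : ℕ) : Fin (m + q + 1) :=
  -- The default `r` is the true input of row `0`; for `i > m` it is never used.
  if h : 1 ≤ i ∧ i ≤ m then r.succAbove (π ⟨m - i, by omega⟩) else r

/-- The chips that enter the columns of the sorting network: those at the sites `0, …, q - 1`. -/
def colInput (π : Perm (Fin (m + q))) (r : Fin (m + q + 1)) (j : ℕ) : Fin (m + q + 1) :=
  if h : j < q then r.succAbove (π ⟨m + j, by omega⟩) else r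

theorem isStage_initialConf (hm : (m + q - 1) / 2 = m) (π : Perm (Fin (m + q)))
    (r : Fin (m + q + 1)) :
    IsStage (rowInput π r) (colInput π r) (fun _ : Fin (m + 1) => 0) (fun _ : Fin q => 0)
      (initialConf π r) := by
  have hbij : Function.Bijective (wireChip (rowInput π r) (colInput π r)
      (fun _ : Fin (m + 1) => 0) (fun _ : Fin q => 0)) := by
    rw [Fintype.bijective_iff_surjective_and_card]
    refine ⟨fun x => ?_, by simp; omega⟩
    rcases Fin.eq_self_or_eq_succAbove r x with rfl | ⟨y, rfl⟩
    · exact ⟨Sum.inl 0, by simp [wireChip, rowWire, carryMax, rowInput]⟩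
    · obtain ⟨P, rfl⟩ := π.surjective y
      by_cases hP : (P : ℕ) < m
      · refine ⟨Sum.inl ⟨m - P, by omega⟩, ?_⟩
        have h1 : 1 ≤ m - (P : ℕ) ∧ m - (P : ℕ) ≤ m := by omega
        have h2 : m - (m - (P : ℕ)) = P := by omega
        simp [wireChip, rowWire, carryMax, rowInput, h1.1, h2]
      · refine ⟨Sum.inr ⟨P - m, by omega⟩, ?_⟩
        have h1 : (P : ℕ) - m < q := by omega
        have h2 : m + ((P : ℕ) - m) = P := by omega
        simp [wireChip, colWire, colInput, h2]
  refine ⟨fun i j => by simp, fun i => Nat.zero_le _, fun j => Nat.zero_le _, hbij, ?_⟩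
  rintro (⟨i, hi⟩ | ⟨j, hj⟩)
  · by_cases h : 1 ≤ i ∧ i ≤ m
    · simp [wireChip, wireSite, rowWire, carryMax, rowInput, h, initialConf, hm]
    · have : i = 0 := by omega
      simp [wireChip, wireSite, rowWire, carryMax, rowInput, this, initialConf]
  · simp [wireChip, wireSite, colWire, colInput, initialConf, hm]

theorem isRToppleable_iff (hm : (m + q - 1) / 2 = m) (π : Perm (Fin (m + q)))
    (r : Fin (m + q + 1)) :
    IsRToppleable π r ↔
      (∀ i < m + 1, ∀ i' < m + 1, (rowInput π r i' : ℕ) = m + q - i → i' ≤ i) ∧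
        ∀ j < q, ∀ j' < q, (colInput π r j' : ℕ) = j → j' ≤ j := by
  have h0 := isStage_initialConf hm π r
  have hfinal : ∀ d, Relation.ReflTransGen ToppleStep (initialConf π r) d → IsFinal d →
      IsStage (rowInput π r) (colInput π r) (fun _ : Fin (m + 1) => q) (fun _ : Fin q => m + 1) d :=
    fun d hd hf => by
      obtain ⟨lam, mu, h1⟩ := h0.of_reflTransGen hd
      obtain ⟨rfl, rfl⟩ := h1.lam_eq_of_isFinal hf
      exact h1
  obtain ⟨d, hd, hf⟩ := h0.exists_isFinal
  have h1 := hfinal d hd hf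
  have hpq : m + 1 + q = m + q + 1 := by omega
  rw [← wireChip_eq_wireRank_iff hpq h0.bij h1.bij]
  constructor
  · intro h
    obtain ⟨e, he, hf', hmono⟩ : (1 : Perm (Fin (m + q + 1))) ∈ toppleResults π r := by
      rw [show toppleResults π r = {1} from h]; rfl
    exact ((hfinal e he hf').strictMono_iff hpq).1 hmono
  · intro h
    refine Set.eq_singleton_iff_unique_mem.2 ⟨⟨d, hd, hf, (h1.strictMono_iff hpq).2 h⟩, ?_⟩
    rintro τ ⟨e, he, hf', hmono⟩
    have h2 := ((hfinal e he hf').strictMono_iff hpq).2 h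
    exact eq_one_of_strictMono fun x y hxy => h2.lt_iff_lt.1 (hmono hxy)

/-- Toppleable permutations are those of bounded displacement. -/
theorem isToppleable_iff (hm : (m + q - 1) / 2 = m) (π : Perm (Fin (m + q))) :
    IsToppleable π ↔
      ∀ P : Fin (m + q), (π P : ℕ) + 1 ≤ P + q ∧ (P : ℕ) ≤ π P + m := by
  simp only [IsToppleable, isRToppleable_iff hm]
  have hv : ∀ (r : Fin (m + q + 1)) (w : Fin (m + q)),
      (w : ℕ) ≤ r.succAbove w ∧ (r.succAbove w : ℕ) ≤ w + 1 := fun r w => by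
    rcases lt_or_ge w.castSucc r with h | h
    · rw [Fin.succAbove_of_castSucc_lt _ _ h]; simp
    · rw [Fin.succAbove_of_le_castSucc _ _ h]; simp
  constructor
  · intro h P
    constructor
    · by_contra! hlt
      -- The worst `r` for the rows equals the entry itself, which is then raised by one.
      have h1 := (h (π P).castSucc).1 (m + q - 1 - π P) (by omega) (m - P) (by omega)
      have h2 : 1 ≤ m - (P : ℕ) ∧ m - (P : ℕ) ≤ m := by omega
      have h3 : m - (m - (P : ℕ)) = P := by omega
      simp only [rowInput, h2, h3, and_self, dite_true, Fin.eta,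
        Fin.succAbove_castSucc_self, Fin.val_succ] at h1
      omega
    · by_contra! hlt
      -- The worst `r` for the columns is just above the entry, which then is not raised.
      have h1 := (h (π P).succ).2 (π P) (by omega) (P - m) (by omega)
      have h2 : (P : ℕ) - m < q := by omega
      have h3 : m + ((P : ℕ) - m) = P := by omega
      simp only [colInput, h2, h3, dite_true, Fin.eta, Fin.succAbove_succ_self,
        Fin.val_castSucc] at h1
      have h4 := h1 trivial
      omega
  · intro h r
    refine ⟨fun i hi i' hi' heq => ?_, fun j hj j' hj' heq => ?_⟩
    · by_cases h1 : 1 ≤ i' ∧ i' ≤ m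
      · have h2 := (h ⟨m - i', by omega⟩).1
        have h3 := hv r (π ⟨m - i', by omega⟩)
        simp only [rowInput, h1, and_self, dite_true] at heq
        simp only at h2
        omega
      · omega
    · have h2 := (h ⟨m + j', by omega⟩).2
      have h3 := hv r (π ⟨m + j', by omega⟩)
      simp only [colInput, hj', dite_true] at heq
      simp only at h2
      omega

/-- Rotating the positions turns toppleable permutations into an excedance class. -/
theorem toppleCount_eq (hm : (m + q - 1) / 2 = m) :
    toppleCount (m + q) = (excedanceClass (m + q) m).ncard := by
  let rot : Fin (m + q) ≃ Fin (m + q) := finAddFlip.trans (finCongr (add_comm q m))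
  have hl : ∀ i : Fin m, (rot (Fin.castAdd q i) : ℕ) = q + i := fun i => by simp [rot, add_comm]
  have hr : ∀ j : Fin q, (rot (Fin.natAdd m j) : ℕ) = j := fun j => by simp [rot]
  have hbij : Set.BijOn (fun π : Perm (Fin (m + q)) => rot.trans π.symm)
      {π | IsToppleable π} (excedanceClass (m + q) m) := by
    let F : Perm (Fin (m + q)) ≃ Perm (Fin (m + q)) :=
      { toFun := fun π => rot.trans π.symm
        invFun := fun σ => (rot.symm.trans σ).symm
        left_inv := fun π => by ext x; simp
        right_inv := fun σ => by ext x; simp }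
    refine F.bijOn fun π => ?_
    change _ ↔ IsToppleable π
    rw [isToppleable_iff hm]
    change {i | i < π.symm (rot i)} = _ ↔ _
    -- Both sides are compared at each `x`, with `P = π.symm (rot x)`. For `x < m` only the first
    -- inequality has content, otherwise only the second; the other holds by the range of the
    -- entries.
    rw [Set.ext_iff, ← (rot.trans π.symm).forall_congr_right
      (q := fun P => (π P : ℕ) + 1 ≤ P + q ∧ (P : ℕ) ≤ π P + m)]
    refine forall_congr' fun x => ?_
    simp only [Set.mem_ofPred_eq, Equiv.trans_apply, Equiv.apply_symm_apply]
    rw [Fin.lt_def]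
    induction x using Fin.addCases with
    | left i =>
      rw [hl]
      simp
      omega
    | right j =>
      rw [hr]
      simp
      omega
  rw [toppleCount, ← hbij.image_eq, hbij.injOn.ncard_image]

end Toppleable

/-! ### Assembly of the two statements. -/

theorem mainTheorem2 :
    (∀ n : ℕ, 1 ≤ n → ∀ s : Fin ((n + 1) / 2) ⊕ Fin (n / 2 + 1),
      toppleCount n =
        (acyclicOrientationsWithSink
          (completeBipartiteGraph (Fin ((n + 1) / 2)) (Fin (n / 2 + 1))) s).ncard) ∧
    (∀ m n : ℕ, 1 ≤ n →
      Set.BijOn (fun σ : Equiv.Perm (Fin (m + n)) => addSink (orientationOfPerm σ))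
        (excedanceClass (m + n) m)
        (acyclicOrientationsWithSink (completeBipartiteGraph (Fin (m + 1)) (Fin n))
          (Sum.inl (Fin.last m)))) := by
  refine ⟨fun n hn => ?_, fun m n _ => addSink_orientationOfPerm_bijOn m n⟩
  -- The left part of size `m + 1` already contains the added sink, so statement (2) applies to `m`
  -- and `q + 1`, whose sum is `n`.
  obtain ⟨m, hm⟩ : ∃ m, (n + 1) / 2 = m + 1 := ⟨(n + 1) / 2 - 1, by omega⟩
  obtain ⟨q, hq⟩ : ∃ q, n / 2 = q := ⟨_, rfl⟩
  obtain rfl : n = m + (q + 1) := by omega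
  rw [hm, hq]
  intro s
  have hbij := addSink_orientationOfPerm_bijOn m (q + 1)
  rw [toppleCount_eq (by omega), ncard_acyclicOrientationsWithSink_of_connected
    completeBipartiteGraph_preconnected s (Sum.inl (Fin.last m)), ← hbij.image_eq,
    hbij.injOn.ncard_image]
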